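/- **Setting.** A (two-dimensional) tile is a unit square with at most one glue on each of its four faces and a label (a finite string); tiles are not rotated. Every glue type $g$ has a strength $\mathrm{str}(g)\in\mathbb{Z}_{\ge 0}$. An assembly is a finite set of tiles placed at distinct points of $\mathbb{Z}^2$. Two abutting faces with equal glue $g$ form a bond of strength $\mathrm{str}(g)$, and all other pairs of faces form none; an assembly is $\tau$-stable if every cut of its weighted bond graph has weight at least $\tau$. For a tile set $T$, a positive integer temperature $\tau$ and a $\tau$-stable seed $S$, write $A\to A'$ if $A'$ is $\tau$-stable and arises from $A$ by placing one tile of $T$ at an empty position. The producible assemblies are those reachable from $S$, and a producible assembly is terminal if no tile can attach to it; the system $(T,S,\tau)$ uniquely assembles $A$ if $A$ is its only terminal assembly. A parallel step $A\rightrightarrows A'$ from a non-terminal assembly $A$ replaces $A$ by the union $A'$ of all $B$ with $A\to B$; the parallel run time of a system with a unique terminal assembly is the number of parallel steps that lead from the seed to it. Let $T$ be a tile set containing exactly one tile $t_0$ labelled "0" and exactly one tile $t_1$ labelled "1". An $m$-bit input template over $T$ consists of an assembly $R$ over $T\setminus\{t_0,t_1\}$ and $m$ distinct positions $B(1),\dots,B(m)\in\mathbb{Z}^2$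 not occupied by $R$; for $r\in\{0,1\}^m$ let $U_r$ be $R$ together with a copy of $t_{r_i}$ at $B(i)$ for every $i$. A $k$-bit output template is a sequence $C(1),\dots,C(k)\in\mathbb{Z}^2$; an assembly represents $c\in\{0,1\}^k$ if its tile at $C(i)$ has label $c_i$ for every $i$. A 2D tile assembly computer (TAC) consists of a tile set $T$, an input template, an output template and a temperature $\tau$. It computes $f:\{0,1\}^m\to\{0,1\}^k$ if for every $r$ the assembly $U_r$ is $\tau$-stable and $(T,U_r,\tau)$ uniquely assembles an assembly that represents $f(r)$. It is an $n$-bit adder if $m=2n$, $k=n+1$ and $f(r_1\dots r_{2n})$ is the $(n+1)$-bit binary representation of the sum of the numbers with binary representations $r_1\dots r_n$ and $r_{n+1}\dots r_{2n}$. Its worst-case run time is the largest parallel run time of $(T,U_r,\tau)$ over all inputs $r$. **Theorem.** There are a 2D $n$-bit adder TAC for every integer $n\ge 1$, all with the same finite tile set and the same temperature, whose worst-case parallel run time is $O(\sqrt n)$: there is a constant $K$ such that, for every $n\ge 1$, the worst-case parallel run time of the $n$-bit adder is at most $K\sqrt n$. -/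

import Mathlib

namespace TileAssembly

/-- A square tile type over the glue alphabet `G`: at most one glue on each face, and a label, which
is a finite string of symbols (symbols are coded by natural numbers). -/
@[ext]
structure TileType (G : Type) where
  north : Option G
  east : Option G
  south : Option G
  west : Option G
  label : List ℕ

/-- The label consisting of the single symbol `0` (for `false`) or `1` (for `true`). -/
def bitLabel (b : Bool) : List ℕ := [b.toNat]

/-- A finite set of tile types over `G`, with the strength of every glue type. -/
structure TileSet (G : Type) where
  tiles : Finset (TileType G)
  str : G → ℕ

/-- Strength of the interaction of two abutting faces: only equal glues interact. -/
noncomputable def glueStrength {G : Type} (str : G → ℕ) (a b : Option G) : ℕ :=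
  open Classical in
  match a, b with
  | some g, some h => if g = h then str g else 0
  | _, _ => 0

/-- Strength of the bond between a tile `s` at position `p` and a tile `t` at position `q`. -/
noncomputable def tileBond {G : Type} (str : G → ℕ) (p : ℤ × ℤ) (s : TileType G)
    (q : ℤ × ℤ) (t : TileType G) : ℕ :=
  if q = (p.1 + 1, p.2) then glueStrength str s.east t.west
  else if q = (p.1 - 1, p.2) then glueStrength str s.west t.east
  else if q = (p.1, p.2 + 1) then glueStrength str s.north t.south
  else if q = (p.1, p.2 - 1) then glueStrength str s.south t.north
  else 0

/-- A two-dimensional assembly: finitely many tiles at distinct integer positions. `tileAt p` is the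
tile at `p`, if there is one; `dom` is the finite set of occupied positions. -/
structure Assembly (G : Type) where
  tileAt : ℤ × ℤ → Option (TileType G)
  dom : Finset (ℤ × ℤ)
  mem_dom : ∀ p, p ∈ dom ↔ tileAt p ≠ none

@[ext]
theorem Assembly.ext {G : Type} {A B : Assembly G} (h : ∀ p, A.tileAt p = B.tileAt p) : A = B := by
  have h1 : A.tileAt = B.tileAt := funext h
  have h2 : A.dom = B.dom := by
    ext p
    rw [A.mem_dom, B.mem_dom, h]
  cases A
  cases B
  cases h1
  cases h2
  rfl

/-- The weight of the edge between positions `p` and `q` in the bond graph of `A`. -/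
noncomputable def Assembly.bond {G : Type} (str : G → ℕ) (A : Assembly G) (p q : ℤ × ℤ) : ℕ :=
  match A.tileAt p, A.tileAt q with
  | some s, some t => tileBond str p s q t
  | _, _ => 0

/-- `A` is `τ`-stable: every cut of its bond graph has weight at least `τ`. -/
def Assembly.Stable {G : Type} (str : G → ℕ) (τ : ℕ) (A : Assembly G) : Prop :=
  ∀ X ⊆ A.dom, X.Nonempty → X ≠ A.dom →
    τ ≤ ∑ p ∈ X, ∑ q ∈ A.dom \ X, A.bond str p q

/-- The assembly `A` with the tile `t` placed at `p`. -/
noncomputable def Assembly.place {G : Type} (A : Assembly G) (p : ℤ × ℤ) (t : TileType G) :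
    Assembly G where
  tileAt := Function.update A.tileAt p (some t)
  dom := insert p A.dom
  mem_dom := by
    intro q
    by_cases h : q = p
    · subst h
      simp
    · simp [h, A.mem_dom]

/-- Tile set, seed assembly and temperature. -/
structure TileSystem (G : Type) where
  tileSet : TileSet G
  seed : Assembly G
  temp : ℕ

namespace TileSystem

variable {G : Type}

/-- The temperature is positive and the seed is stable at this temperature. -/
def IsValid (Γ : TileSystem G) : Prop :=
  0 < Γ.temp ∧ Γ.seed.Stable Γ.tileSet.str Γ.temp

/-- `A → A'`: some tile of the tile set attaches to `A` at an empty position, and the resulting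
assembly `A'` is stable. -/
def Attaches (Γ : TileSystem G) (A A' : Assembly G) : Prop :=
  ∃ t ∈ Γ.tileSet.tiles, ∃ p, A.tileAt p = none ∧ A' = A.place p t ∧
    A'.Stable Γ.tileSet.str Γ.temp

/-- The producible assemblies. -/
inductive Producible (Γ : TileSystem G) : Assembly G → Prop
  | seed : Producible Γ Γ.seed
  | attach {A A' : Assembly G} : Producible Γ A → Γ.Attaches A A' → Producible Γ A'

/-- The set of terminal assemblies. -/
def term (Γ : TileSystem G) : Set (Assembly G) :=
  {A | Γ.Producible A ∧ ∀ A', ¬ Γ.Attaches A A'}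

/-- `A` is the one and only terminal assembly. -/
def UniquelyAssembles (Γ : TileSystem G) (A : Assembly G) : Prop :=
  Γ.term = {A}

/-- `A ⇉ A'`: at least one tile can attach to `A`, and `A'` is the union of all the assemblies that
arise from `A` by one attachment. (If two different tiles can attach to `A` at the same position,
this union is not an assembly and there is no such `A'`.) -/
def ParallelStep (Γ : TileSystem G) (A A' : Assembly G) : Prop :=
  (∃ B, Γ.Attaches A B) ∧
    ∀ p t, A'.tileAt p = some t ↔ ∃ B, Γ.Attaches A B ∧ B.tileAt p = some t

/-- The parallel run time is `k`: `k` parallel steps lead from the seed to the unique terminal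
assembly. (No parallel step leaves a terminal assembly, so `k` is unique.) -/
def HasParallelRunTime (Γ : TileSystem G) (k : ℕ) : Prop :=
  ∃ A : ℕ → Assembly G, A 0 = Γ.seed ∧ (∀ i < k, Γ.ParallelStep (A i) (A (i + 1))) ∧
    Γ.term = {A k}

end TileSystem

/-- An `n`-bit input template over the tile set `T`, which has exactly one tile labelled `0` and
exactly one tile labelled `1`: an assembly `frame` over the other tiles, and a sequence `pos` of
distinct wildcard positions outside of it. -/
structure InputTemplate {G : Type} (T : TileSet G) (n : ℕ) where
  bitTile : Bool → TileType G
  bitTile_mem : ∀ c, bitTile c ∈ T.tiles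
  label_bitTile : ∀ c, (bitTile c).label = bitLabel c
  eq_bitTile : ∀ c, ∀ t ∈ T.tiles, t.label = bitLabel c → t = bitTile c
  frame : Assembly G
  frame_over : ∀ p t, frame.tileAt p = some t → t ∈ T.tiles ∧ ∀ c, t ≠ bitTile c
  pos : Fin n → ℤ × ℤ
  pos_injective : Function.Injective pos
  frame_pos : ∀ i, frame.tileAt (pos i) = none

/-- The template filled with the bit string `b`: the frame together with a copy of the tile
labelled `b i` at the wildcard position `pos i`, for every `i`. -/
noncomputable def InputTemplate.fill {G : Type} {T : TileSet G} {n : ℕ} (U : InputTemplate T n)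
    (b : Fin n → Bool) : Assembly G :=
  open Classical in
  { tileAt := fun p => if h : ∃ i, U.pos i = p then some (U.bitTile (b h.choose))
      else U.frame.tileAt p
    dom := U.frame.dom ∪ Finset.univ.image U.pos
    mem_dom := by
      intro p
      by_cases h : ∃ i, U.pos i = p
      · simp [h]
      · simp [h, U.frame.mem_dom] }

theorem InputTemplate.fill_pos {G : Type} {T : TileSet G} {n : ℕ} (U : InputTemplate T n)
    (b : Fin n → Bool) (i : Fin n) : (U.fill b).tileAt (U.pos i) = some (U.bitTile (b i)) := by
  have h : ∃ j, U.pos j = U.pos i := ⟨i, rfl⟩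
  have hc : h.choose = i := U.pos_injective h.choose_spec
  simp only [InputTemplate.fill, dif_pos h, hc]

theorem InputTemplate.fill_of_ne {G : Type} {T : TileSet G} {n : ℕ} (U : InputTemplate T n)
    (b : Fin n → Bool) (p : ℤ × ℤ) (hp : ∀ i, U.pos i ≠ p) :
    (U.fill b).tileAt p = U.frame.tileAt p := by
  have h : ¬ ∃ j, U.pos j = p := fun ⟨j, hj⟩ => hp j hj
  simp only [InputTemplate.fill, dif_neg h]

/-- A two-dimensional tile assembly computer with `n` input bits and `k` output bits: tile set,
input template, output template (a sequence of `k` positions) and temperature. -/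
structure TAC (G : Type) (n k : ℕ) where
  tileSet : TileSet G
  input : InputTemplate tileSet n
  output : Fin k → ℤ × ℤ
  temp : ℕ

/-- `A` represents the bit string `c` over the output template `V`. -/
def Represents {G : Type} {k : ℕ} (V : Fin k → ℤ × ℤ) (A : Assembly G) (c : Fin k → Bool) : Prop :=
  ∀ i, ∃ t, A.tileAt (V i) = some t ∧ t.label = bitLabel (c i)

/-- The natural number with binary numeral `r 0, r 1, …, r (m - 1)`, most significant bit first. -/
def binaryValue {m : ℕ} (r : Fin m → Bool) : ℕ :=
  ∑ i, (r i).toNat * 2 ^ (i.rev : ℕ)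

namespace TAC

variable {G : Type} {n k : ℕ}

/-- The tile system that runs the computer on input `b`. -/
noncomputable def system (I : TAC G n k) (b : Fin n → Bool) : TileSystem G where
  tileSet := I.tileSet
  seed := I.input.fill b
  temp := I.temp

/-- For every input `b`, the seed is a legitimate one and the system uniquely assembles an assembly
that represents `f b`. -/
def Computes (I : TAC G n k) (f : (Fin n → Bool) → (Fin k → Bool)) : Prop :=
  ∀ b, (I.system b).IsValid ∧
    ∃ A, (I.system b).UniquelyAssembles A ∧ Represents I.output A (f b)

/-- The worst case parallel run time is `w`: every input has a run time, and `w` is the largest. -/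
def HasWorstCaseRunTime (I : TAC G n k) (w : ℕ) : Prop :=
  (∀ b, ∃ l ≤ w, (I.system b).HasParallelRunTime l) ∧
    ∃ b, (I.system b).HasParallelRunTime w

/-- The computer computes the `n + 1` bits of the sum of the two numbers that are given by the first
`n` and by the last `n` input bits. -/
def IsAdder (n : ℕ) (I : TAC G (n + n) (n + 1)) : Prop :=
  ∃ f : (Fin (n + n) → Bool) → (Fin (n + 1) → Bool),
    (∀ r, binaryValue (f r) =
      binaryValue (fun i : Fin n => r (Fin.castAdd n i)) +
        binaryValue (fun i : Fin n => r (Fin.natAdd n i))) ∧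
    I.Computes f

end TAC

end TileAssembly

/-! Let `s = ⌊√n⌋ + 1`, so that `n < s * s`. Both numbers, padded by zeros, are written in a square
of `s` blocks of `s` columns, least significant digits first. A run of digits acts on the carry that
enters it as the identity or as a constant. This action needs three values only and can be computed
before the carry is known. All blocks do so at the same time, by a row of tiles that grows east in
`2 * s` steps. A column at the east end climbs five positions per block, applies the action of the
block to the carry and takes the result to the next block. On its way it starts in every block a row
that returns west in about `2 * s` steps; this row meets the stored prefix actions and turns them
into sum bits. The total is `9 * s + O(1)` steps.

The labels 0 and 1 have one tile each, so the output is written with the input tiles. Their south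
glue holds them to the frame, hence an output value has to enter through another face: a sum bit
moves one position west, then up, then back east.

Correctness at temperature 2 rests on giving every glue other than `z` one face through which it is
read. On that face a glue never looks at an empty position, and neither does `z` on any face. The
inputs of each tile that can grow have total strength exactly 2, so it attaches only if all of them
match (`matched_of_pull`). Matching inputs identify tile and position (`Cell.of_inputs`), and the
final assembly supplies them at lower rank (`Cell.exists_source`). These facts form a `GrowthPlan`,
from which the unique terminal assembly and the run time follow in general. -/

namespace TileAssembly

/-! ### Bonds, cuts and stability -/

/-- The four faces of a tile. -/
inductive Dir
  | n | e | s | w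
  deriving DecidableEq

namespace Dir

instance : Fintype Dir where
  elems := {n, e, s, w}
  complete := by intro d; cases d <;> decide

/-- The face of the abutting tile that meets a given face. -/
def opp : Dir → Dir
  | n => s
  | e => w
  | s => n
  | w => e

/-- The position that abuts `p` in a given direction. -/
def move (p : ℤ × ℤ) : Dir → ℤ × ℤ
  | n => (p.1, p.2 + 1)
  | e => (p.1 + 1, p.2)
  | s => (p.1, p.2 - 1)
  | w => (p.1 - 1, p.2)

theorem move_opp (p : ℤ × ℤ) (d : Dir) : d.opp.move (d.move p) = p := by
  cases d <;> simp [opp, move]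

theorem sum_univ {M : Type*} [AddCommMonoid M] (f : Dir → M) :
    ∑ d, f d = f n + f e + f s + f w := by
  change ∑ d ∈ {n, e, s, w}, f d = _
  simp [add_assoc]

end Dir

section Glues

variable {G : Type} (str : G → ℕ)

/-- The glue on a face. -/
def TileType.face (t : TileType G) : Dir → Option G
  | .n => t.north
  | .e => t.east
  | .s => t.south
  | .w => t.west

theorem glueStrength_comm (a b : Option G) : glueStrength str a b = glueStrength str b a := by
  cases a <;> cases b <;> simp only [glueStrength]
  rename_i g h
  by_cases hgh : g = h
  · subst hgh; rfl
  · rw [if_neg hgh, if_neg (Ne.symm hgh)]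

theorem glueStrength_none_right (a : Option G) : glueStrength str a none = 0 := by
  cases a <;> rfl

theorem glueStrength_self (g : G) : glueStrength str (some g) (some g) = str g := by
  simp [glueStrength]

theorem exists_of_glueStrength_pos {a b : Option G} (h : 0 < glueStrength str a b) :
    ∃ g, a = some g ∧ b = some g := by
  rcases a with _ | g <;> rcases b with _ | g'
  iterate 3 exact absurd h (lt_irrefl 0)
  simp only [glueStrength] at h
  split_ifs at h with hg
  · exact ⟨g, rfl, by rw [hg]⟩
  · omega

theorem tileBond_comm (p q : ℤ × ℤ) (s t : TileType G) :
    tileBond str p s q t = tileBond str q t p s := by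
  obtain ⟨a, b⟩ := p
  obtain ⟨c, d⟩ := q
  simp only [tileBond, Prod.mk.injEq]
  split_ifs <;> first | omega | rfl | exact glueStrength_comm str _ _

theorem Assembly.bond_comm (A : Assembly G) (p q : ℤ × ℤ) : A.bond str p q = A.bond str q p := by
  unfold Assembly.bond
  cases A.tileAt p <;> cases A.tileAt q <;> simp only []
  exact tileBond_comm str _ _ _ _

/-- At most one direction leads from `p` to `q`, so the nested cases become a sum; in this form it
can be interchanged with the sum over an assembly. -/
theorem tileBond_eq_sum (p q : ℤ × ℤ) (t u : TileType G) :
    tileBond str p t q u =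
      ∑ d : Dir, if q = d.move p then glueStrength str (t.face d) (u.face d.opp) else 0 := by
  obtain ⟨a, b⟩ := p
  obtain ⟨c, d⟩ := q
  rw [Dir.sum_univ]
  simp only [tileBond, Dir.move, TileType.face, Dir.opp, Prod.mk.injEq]
  split_ifs <;> omega

theorem Assembly.str_le_bond (A : Assembly G) {p : ℤ × ℤ} {d : Dir} {t u : TileType G} {g : G}
    (ht : A.tileAt p = some t) (hu : A.tileAt (d.move p) = some u) (htg : t.face d = some g)
    (hug : u.face d.opp = some g) : str g ≤ A.bond str p (d.move p) := by
  simp only [Assembly.bond, ht, hu, tileBond_eq_sum]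
  refine le_trans ?_ (Finset.single_le_sum (fun _ _ => Nat.zero_le _) (Finset.mem_univ d))
  rw [if_pos rfl, htg, hug, glueStrength_self]

/-- The glue that `A` presents at the face `d` of position `p`. -/
def Assembly.faceAt (A : Assembly G) (p : ℤ × ℤ) (d : Dir) : Option G :=
  (A.tileAt p).bind fun t => t.face d

/-- The total strength by which `A` binds a tile `t` placed at `p`. -/
noncomputable def Assembly.pull (A : Assembly G) (p : ℤ × ℤ) (t : TileType G) : ℕ :=
  ∑ d : Dir, glueStrength str (t.face d) (A.faceAt (d.move p) d.opp)

theorem Assembly.mem_dom_of_eq {A : Assembly G} {p : ℤ × ℤ} {t : TileType G}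
    (h : A.tileAt p = some t) : p ∈ A.dom := by
  rw [A.mem_dom, h]
  exact Option.some_ne_none t

theorem Assembly.exists_of_mem_dom {A : Assembly G} {p : ℤ × ℤ} (h : p ∈ A.dom) :
    ∃ t, A.tileAt p = some t :=
  Option.ne_none_iff_exists'.1 ((A.mem_dom p).1 h)

theorem Assembly.notMem_dom {A : Assembly G} {p : ℤ × ℤ} : p ∉ A.dom ↔ A.tileAt p = none := by
  rw [A.mem_dom, not_not]

theorem Assembly.place_self (A : Assembly G) (p : ℤ × ℤ) (t : TileType G) :
    (A.place p t).tileAt p = some t := by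
  simp [Assembly.place]

theorem Assembly.place_of_ne (A : Assembly G) {p q : ℤ × ℤ} (t : TileType G) (h : q ≠ p) :
    (A.place p t).tileAt q = A.tileAt q := by
  simp [Assembly.place, h]

theorem Assembly.bond_place_of_ne (A : Assembly G) {p q r : ℤ × ℤ} (t : TileType G) (hq : q ≠ p)
    (hr : r ≠ p) : (A.place p t).bond str q r = A.bond str q r := by
  unfold Assembly.bond
  rw [A.place_of_ne t hq, A.place_of_ne t hr]

theorem Assembly.sum_bond_place (A : Assembly G) {p : ℤ × ℤ} (t : TileType G)
    (hp : A.tileAt p = none) : ∑ q ∈ A.dom, (A.place p t).bond str p q = A.pull str p t := by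
  have h1 : ∀ q ∈ A.dom, (A.place p t).bond str p q =
      ∑ d : Dir, if q = d.move p then
        glueStrength str (t.face d) (A.faceAt (d.move p) d.opp) else 0 := by
    intro q hq
    obtain ⟨u, hu⟩ := A.exists_of_mem_dom hq
    have hqp : q ≠ p := by
      rintro rfl
      simp [hp] at hu
    unfold Assembly.bond
    rw [A.place_self, A.place_of_ne t hqp, hu]
    simp only [tileBond_eq_sum]
    refine Finset.sum_congr rfl fun d _ => ?_
    split_ifs with h
    · simp [Assembly.faceAt, ← h, hu]
    · rfl
  rw [Finset.sum_congr rfl h1, Finset.sum_comm]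
  refine Finset.sum_congr rfl fun d _ => ?_
  rw [Finset.sum_ite_eq' A.dom (d.move p)]
  split_ifs with h
  · rfl
  · rw [Assembly.faceAt, A.notMem_dom.1 h]
    exact (glueStrength_none_right str _).symm

/-- A cut of the larger assembly either isolates the new tile, and then weighs its pull, or
restricts to a cut of `A` that weighs no more. -/
theorem Assembly.Stable.place {A : Assembly G} {τ : ℕ} (hA : A.Stable str τ) {p : ℤ × ℤ}
    {t : TileType G} (hp : A.tileAt p = none) (ht : τ ≤ A.pull str p t) :
    (A.place p t).Stable str τ := by
  intro X hX hne hX'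
  have hpd : p ∉ A.dom := A.notMem_dom.2 hp
  have hdom : (A.place p t).dom = insert p A.dom := rfl
  rw [hdom] at hX hX' ⊢
  have hmono : ∀ Y Z : Finset (ℤ × ℤ), Y ⊆ A.dom → Z ⊆ A.dom →
      ∑ q ∈ Y, ∑ r ∈ Z, A.bond str q r = ∑ q ∈ Y, ∑ r ∈ Z, (A.place p t).bond str q r := by
    intro Y Z hY hZ
    refine Finset.sum_congr rfl fun q hq => Finset.sum_congr rfl fun r hr => ?_
    rw [A.bond_place_of_ne str t (ne_of_mem_of_not_mem (hY hq) hpd)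
      (ne_of_mem_of_not_mem (hZ hr) hpd)]
  have hsub : ∀ Y Z Y' Z' : Finset (ℤ × ℤ), Y ⊆ Y' → Z ⊆ Z' →
      ∑ q ∈ Y, ∑ r ∈ Z, (A.place p t).bond str q r ≤
        ∑ q ∈ Y', ∑ r ∈ Z', (A.place p t).bond str q r := fun Y Z Y' Z' hY hZ =>
    (Finset.sum_le_sum_of_subset hY).trans
      (Finset.sum_le_sum fun q _ => Finset.sum_le_sum_of_subset hZ)
  by_cases hpX : p ∈ X
  · by_cases h0 : X = {p}
    · subst h0
      have : insert p A.dom \ {p} = A.dom := by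
        rw [Finset.insert_sdiff_of_mem _ (Finset.mem_singleton_self p)]
        exact Finset.sdiff_singleton_eq_erase p A.dom ▸ Finset.erase_eq_of_notMem hpd
      rw [this, Finset.sum_singleton, A.sum_bond_place str t hp]
      exact ht
    · have h1 : X.erase p ⊆ A.dom := fun q hq => by
        have := hX (Finset.mem_of_mem_erase hq)
        exact (Finset.mem_insert.1 this).resolve_left (Finset.ne_of_mem_erase hq)
      have h2 : (X.erase p).Nonempty := by
        rw [Finset.nonempty_iff_ne_empty]
        intro h
        rcases Finset.erase_eq_empty_iff X p |>.1 h with h | h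
        · exact hne.ne_empty h
        · exact h0 h
      have h3 : X.erase p ≠ A.dom := fun h => hX' (by rw [← h, Finset.insert_erase hpX])
      refine (hA _ h1 h2 h3).trans ?_
      rw [hmono _ _ h1 Finset.sdiff_subset]
      refine hsub _ _ _ _ (Finset.erase_subset _ _) ?_
      intro q hq
      rw [Finset.mem_sdiff, Finset.mem_erase] at hq
      rw [Finset.mem_sdiff]
      refine ⟨Finset.mem_insert_of_mem hq.1, fun h => hq.2 ⟨?_, h⟩⟩
      rintro rfl
      exact hpd hq.1
  · have h1 : X ⊆ A.dom := fun q hq =>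
      (Finset.mem_insert.1 (hX hq)).resolve_left (fun h => hpX (h ▸ hq))
    by_cases h0 : X = A.dom
    · subst h0
      refine ht.trans ?_
      rw [← A.sum_bond_place str t hp]
      refine Finset.sum_le_sum fun q hq => ?_
      rw [Assembly.bond_comm]
      refine Finset.single_le_sum (f := fun r => (A.place p t).bond str q r)
        (fun _ _ => Nat.zero_le _) ?_
      simp [hpd]
    · refine (hA _ h1 hne h0).trans ?_
      rw [hmono _ _ h1 Finset.sdiff_subset]
      exact hsub _ _ _ _ subset_rfl (Finset.sdiff_subset_sdiff (Finset.subset_insert _ _) subset_rfl)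

/-- The cut that isolates the new tile weighs exactly its pull; it is a proper cut because `A` is
nonempty. -/
theorem Assembly.Stable.le_pull {A : Assembly G} {τ : ℕ} {p : ℤ × ℤ}
    {t : TileType G} (hp : A.tileAt p = none) (hne : A.dom.Nonempty)
    (h : (A.place p t).Stable str τ) : τ ≤ A.pull str p t := by
  have hpd : p ∉ A.dom := A.notMem_dom.2 hp
  have hdom : (A.place p t).dom = insert p A.dom := rfl
  have hsd : insert p A.dom \ {p} = A.dom := by
    rw [Finset.insert_sdiff_of_mem _ (Finset.mem_singleton_self p)]
    exact Finset.sdiff_singleton_eq_erase p A.dom ▸ Finset.erase_eq_of_notMem hpd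
  have := h {p} (by simp [hdom]) (Finset.singleton_nonempty p) (by
    rw [hdom]
    intro heq
    obtain ⟨q, hq⟩ := hne
    have : q ∈ ({p} : Finset (ℤ × ℤ)) := heq ▸ Finset.mem_insert_of_mem hq
    exact hpd (Finset.mem_singleton.1 this ▸ hq))
  rwa [hdom, hsd, Finset.sum_singleton, A.sum_bond_place str t hp] at this

/-- An assembly with a spanning tree of bonds of strength at least `τ` is `τ`-stable. -/
theorem Assembly.stable_of_tree (A : Assembly G) (τ : ℕ) (rank : ℤ × ℤ → ℕ) (root : ℤ × ℤ)
    (h : ∀ p ∈ A.dom, p ≠ root → ∃ q ∈ A.dom, rank q < rank p ∧ τ ≤ A.bond str p q) :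
    A.Stable str τ := by
  -- On the side without the root, the position of least rank has its tree edge to a still lower
  -- one, hence across the cut.
  have key : ∀ Y ⊆ A.dom, Y.Nonempty → root ∉ Y →
      ∃ p ∈ Y, ∃ q ∈ A.dom, q ∉ Y ∧ τ ≤ A.bond str p q := by
    intro Y hY hne hr
    obtain ⟨p, hp, hmin⟩ := Finset.exists_min_image Y rank hne
    obtain ⟨q, hq, hlt, hb⟩ := h p (hY hp) (fun h => hr (h ▸ hp))
    exact ⟨p, hp, q, hq, fun hqY => absurd (hmin q hqY) (not_le.2 hlt), hb⟩
  intro X hX hne hne'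
  have hle : ∀ p ∈ X, ∀ q ∈ A.dom \ X, A.bond str p q ≤
      ∑ p ∈ X, ∑ q ∈ A.dom \ X, A.bond str p q := by
    intro p hp q hq
    refine (Finset.single_le_sum (f := fun q => A.bond str p q) (fun _ _ => Nat.zero_le _)
      hq).trans ?_
    exact Finset.single_le_sum (f := fun p => ∑ q ∈ A.dom \ X, A.bond str p q)
      (fun _ _ => Nat.zero_le _) hp
  by_cases hr : root ∈ X
  · obtain ⟨p, hp, q, hq, hqn, hb⟩ := key (A.dom \ X) Finset.sdiff_subset (by
      rw [Finset.sdiff_nonempty]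
      exact fun h => hne' (hX.antisymm h)) (by simp [hr])
    rw [Assembly.bond_comm] at hb
    refine hb.trans (hle q ?_ p hp)
    by_contra hqX
    exact hqn (Finset.mem_sdiff.2 ⟨hq, hqX⟩)
  · obtain ⟨p, hp, q, hq, hqn, hb⟩ := key X hX hne hr
    exact hb.trans (hle p hp q (Finset.mem_sdiff.2 ⟨hq, hqn⟩))

/-- The tiles of `A` at the positions of `P`. -/
noncomputable def Assembly.restrict (A : Assembly G) (P : Finset (ℤ × ℤ)) : Assembly G where
  tileAt := fun p => if p ∈ P then A.tileAt p else none
  dom := A.dom.filter (· ∈ P)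
  mem_dom := by
    intro p
    by_cases h : p ∈ P <;> simp [h, A.mem_dom]

end Glues

/-! ### Growth plans: unique assembly and run time -/

namespace TileSystem

variable {G : Type} (Γ : TileSystem G)

/-- A sub-assembly of `F` that contains the seed, and with every tile the tiles at the positions
that it needs. -/
structure Closed (F : Assembly G) (dep : ℤ × ℤ → Set (ℤ × ℤ)) (A : Assembly G) : Prop where
  seed_le : ∀ p t, Γ.seed.tileAt p = some t → A.tileAt p = some t
  le : ∀ p t, A.tileAt p = some t → F.tileAt p = some t
  dep_mem : ∀ p ∈ A.dom, ∀ q ∈ dep p, q ∈ A.dom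

/-- A plan of the growth of `F` from the seed: a tile can attach to a closed assembly if and only if
it is the tile of `F` at a position all of whose needs are met. The needs of a position have a
smaller rank or belong to the seed. -/
structure GrowthPlan (F : Assembly G) (dep : ℤ × ℤ → Set (ℤ × ℤ)) (rank : ℤ × ℤ → ℕ) : Prop where
  valid : Γ.IsValid
  nonempty : Γ.seed.dom.Nonempty
  closed_seed : Γ.Closed F dep Γ.seed
  sound : ∀ A, Γ.Closed F dep A → ∀ p, A.tileAt p = none → ∀ t ∈ Γ.tileSet.tiles,
    Γ.temp ≤ A.pull Γ.tileSet.str p t → F.tileAt p = some t ∧ ∀ q ∈ dep p, q ∈ A.dom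
  complete : ∀ A, Γ.Closed F dep A → ∀ p, A.tileAt p = none → ∀ t, F.tileAt p = some t →
    (∀ q ∈ dep p, q ∈ A.dom) → t ∈ Γ.tileSet.tiles ∧ Γ.temp ≤ A.pull Γ.tileSet.str p t
  rank_lt : ∀ p ∈ F.dom, p ∉ Γ.seed.dom → ∀ q ∈ dep p,
    q ∈ Γ.seed.dom ∨ q ∈ F.dom ∧ rank q < rank p

namespace GrowthPlan

variable {Γ} {F : Assembly G} {dep : ℤ × ℤ → Set (ℤ × ℤ)} {rank : ℤ × ℤ → ℕ}

theorem Closed_dom_subset {A : Assembly G} (hA : Γ.Closed F dep A) : A.dom ⊆ F.dom := by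
  intro p hp
  obtain ⟨t, ht⟩ := A.exists_of_mem_dom hp
  exact Assembly.mem_dom_of_eq (hA.le p t ht)

theorem seed_dom_subset {A : Assembly G} (hA : Γ.Closed F dep A) : Γ.seed.dom ⊆ A.dom := by
  intro p hp
  obtain ⟨t, ht⟩ := Γ.seed.exists_of_mem_dom hp
  exact Assembly.mem_dom_of_eq (hA.seed_le p t ht)

theorem Closed_place {A : Assembly G} (hA : Γ.Closed F dep A) {p : ℤ × ℤ} {t : TileType G}
    (hp : A.tileAt p = none) (ht : F.tileAt p = some t) (hd : ∀ q ∈ dep p, q ∈ A.dom) :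
    Γ.Closed F dep (A.place p t) where
  seed_le q u hq := by
    have := hA.seed_le q u hq
    rwa [A.place_of_ne]
    rintro rfl
    simp [hp] at this
  le q u hq := by
    by_cases h : q = p
    · subst h
      rw [A.place_self] at hq
      rw [ht, hq]
    · rw [A.place_of_ne t h] at hq
      exact hA.le q u hq
  dep_mem q hq r hr := by
    rcases Finset.mem_insert.1 hq with rfl | hq
    · exact Finset.mem_insert_of_mem (hd r hr)
    · exact Finset.mem_insert_of_mem (hA.dep_mem q hq r hr)

theorem attaches_iff (h : Γ.GrowthPlan F dep rank) {A B : Assembly G} (hA : Γ.Closed F dep A)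
    (hs : A.Stable Γ.tileSet.str Γ.temp) :
    Γ.Attaches A B ↔ ∃ p t, A.tileAt p = none ∧ F.tileAt p = some t ∧
      (∀ q ∈ dep p, q ∈ A.dom) ∧ B = A.place p t := by
  constructor
  · rintro ⟨t, ht, p, hp, rfl, hst⟩
    obtain ⟨h1, h2⟩ := h.sound A hA p hp t ht
      (hst.le_pull _ hp (h.nonempty.mono (seed_dom_subset hA)))
    exact ⟨p, t, hp, h1, h2, rfl⟩
  · rintro ⟨p, t, hp, ht, hd, rfl⟩
    obtain ⟨h1, h2⟩ := h.complete A hA p hp t ht hd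
    exact ⟨t, h1, p, hp, rfl, hs.place _ hp h2⟩

theorem closed_and_stable (h : Γ.GrowthPlan F dep rank) {A : Assembly G} (hA : Γ.Producible A) :
    Γ.Closed F dep A ∧ A.Stable Γ.tileSet.str Γ.temp := by
  induction hA with
  | seed => exact ⟨h.closed_seed, h.valid.2⟩
  | attach _ hAB ih =>
    obtain ⟨p, t, hp, ht, hd, rfl⟩ := (h.attaches_iff ih.1 ih.2).1 hAB
    obtain ⟨_, _, _, _, _, hst⟩ := hAB
    exact ⟨Closed_place ih.1 hp ht hd, hst⟩

theorem eq_of_dom_subset {A : Assembly G} (hA : Γ.Closed F dep A) (h : F.dom ⊆ A.dom) :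
    A = F := by
  ext1 p
  by_cases hp : p ∈ A.dom
  · obtain ⟨t, ht⟩ := A.exists_of_mem_dom hp
    rw [ht, hA.le p t ht]
  · rw [A.notMem_dom.1 hp, F.notMem_dom.1 fun h' => hp (h h')]

/-- Among the positions of `F` that are still empty, one of least rank has all its needs met. -/
theorem exists_attaches (h : Γ.GrowthPlan F dep rank) {A : Assembly G} (hA : Γ.Producible A)
    (hne : A ≠ F) : ∃ B, Γ.Attaches A B := by
  obtain ⟨hc, hs⟩ := h.closed_and_stable hA
  have hex : (F.dom \ A.dom).Nonempty := by
    rw [Finset.sdiff_nonempty]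
    exact fun h' => hne (eq_of_dom_subset hc h')
  obtain ⟨p, hp, hmin⟩ := Finset.exists_min_image _ rank hex
  rw [Finset.mem_sdiff] at hp
  obtain ⟨t, ht⟩ := F.exists_of_mem_dom hp.1
  refine ⟨A.place p t, (h.attaches_iff hc hs).2 ⟨p, t, A.notMem_dom.1 hp.2, ht, ?_, rfl⟩⟩
  intro q hq
  rcases h.rank_lt p hp.1 (fun hps => hp.2 (seed_dom_subset hc hps)) q hq with hq | ⟨hqF, hlt⟩
  · exact seed_dom_subset hc hq
  · by_contra hqA
    exact absurd (hmin q (Finset.mem_sdiff.2 ⟨hqF, hqA⟩)) (not_le.2 hlt)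

theorem not_attaches (h : Γ.GrowthPlan F dep rank) (hF : Γ.Producible F) (B : Assembly G) :
    ¬ Γ.Attaches F B := by
  obtain ⟨hc, hs⟩ := h.closed_and_stable hF
  intro hB
  obtain ⟨p, t, hp, ht, -⟩ := (h.attaches_iff hc hs).1 hB
  simp [hp] at ht

open Classical in
/-- The positions occupied after a given number of parallel steps. -/
noncomputable def stage (Γ : TileSystem G) (F : Assembly G) (dep : ℤ × ℤ → Set (ℤ × ℤ)) :
    ℕ → Finset (ℤ × ℤ)
  | 0 => Γ.seed.dom
  | k + 1 => stage Γ F dep k ∪ F.dom.filter fun p => ∀ q ∈ dep p, q ∈ stage Γ F dep k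

theorem mem_stage_succ {k : ℕ} {p : ℤ × ℤ} : p ∈ stage Γ F dep (k + 1) ↔
    p ∈ stage Γ F dep k ∨ p ∈ F.dom ∧ ∀ q ∈ dep p, q ∈ stage Γ F dep k := by
  simp [stage]

theorem restrict_seed (h : Γ.GrowthPlan F dep rank) : F.restrict Γ.seed.dom = Γ.seed := by
  ext1 p
  by_cases hp : p ∈ Γ.seed.dom
  · obtain ⟨t, ht⟩ := Γ.seed.exists_of_mem_dom hp
    simp [Assembly.restrict, hp, ht, h.closed_seed.le p t ht]
  · simp [Assembly.restrict, hp, Γ.seed.notMem_dom.1 hp]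

theorem restrict_insert {P : Finset (ℤ × ℤ)} {p : ℤ × ℤ} {t : TileType G}
    (ht : F.tileAt p = some t) : F.restrict (insert p P) = (F.restrict P).place p t := by
  ext1 q
  by_cases hq : q = p
  · subst hq
    rw [Assembly.place_self]
    simp [Assembly.restrict, ht]
  · rw [Assembly.place_of_ne _ _ hq]
    simp [Assembly.restrict, hq]

/-- One parallel step is simulated by single attachments: the needs of the new positions lie in `P`,
so the order does not matter. -/
theorem producible_restrict_union (h : Γ.GrowthPlan F dep rank) {P : Finset (ℤ × ℤ)}
    (hPF : P ⊆ F.dom) (hP : Γ.Producible (F.restrict P)) (N : Finset (ℤ × ℤ)) (hN : N ⊆ F.dom)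
    (hd : ∀ p ∈ N, ∀ q ∈ dep p, q ∈ P) : Γ.Producible (F.restrict (P ∪ N)) := by
  induction N using Finset.induction_on with
  | empty => simpa using hP
  | insert p N hpN ih =>
    have ih := ih (fun q hq => hN (Finset.mem_insert_of_mem hq))
      (fun q hq => hd q (Finset.mem_insert_of_mem hq))
    rw [Finset.union_insert]
    by_cases hp : p ∈ P ∪ N
    · rwa [Finset.insert_eq_of_mem hp]
    · obtain ⟨t, ht⟩ := F.exists_of_mem_dom (hN (Finset.mem_insert_self p N))
      rw [restrict_insert ht]
      refine ih.attach ?_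
      obtain ⟨hc, hs⟩ := h.closed_and_stable ih
      refine (h.attaches_iff hc hs).2 ⟨p, t, ?_, ht, ?_, rfl⟩
      · simp only [Assembly.restrict, if_neg hp]
      · intro q hq
        have hq := hd p (Finset.mem_insert_self p N) q hq
        exact Finset.mem_filter.2 ⟨hPF hq, Finset.mem_union_left _ hq⟩

theorem stage_subset (h : Γ.GrowthPlan F dep rank) (k : ℕ) : stage Γ F dep k ⊆ F.dom := by
  induction k with
  | zero => exact Closed_dom_subset h.closed_seed
  | succ k ih => exact fun p hp => (mem_stage_succ.1 hp).elim (fun hp => ih hp) And.left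

theorem producible_stage (h : Γ.GrowthPlan F dep rank) (k : ℕ) :
    Γ.Producible (F.restrict (stage Γ F dep k)) := by
  induction k with
  | zero =>
    rw [stage, h.restrict_seed]
    exact .seed
  | succ k ih =>
    classical
    exact h.producible_restrict_union (h.stage_subset k) ih _
      (fun p hp => (Finset.mem_filter.1 hp).1) fun p hp => (Finset.mem_filter.1 hp).2

theorem stage_mono : Monotone (stage Γ F dep) :=
  monotone_nat_of_le_succ fun _ => Finset.subset_union_left

theorem mem_stage (h : Γ.GrowthPlan F dep rank) :
    ∀ (k : ℕ) (p : ℤ × ℤ), p ∈ F.dom → rank p < k → p ∈ stage Γ F dep k := by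
  intro k
  induction k with
  | zero => intro p _ hk; omega
  | succ k ih =>
    intro p hp hk
    by_cases hps : p ∈ Γ.seed.dom
    · exact stage_mono (Nat.zero_le (k + 1)) hps
    · refine mem_stage_succ.2 (.inr ⟨hp, fun q hq => ?_⟩)
      rcases h.rank_lt p hp hps q hq with hq | ⟨hqF, hlt⟩
      · exact stage_mono (Nat.zero_le k) hq
      · exact ih q hqF (by omega)

theorem parallelStep (h : Γ.GrowthPlan F dep rank) (k : ℕ)
    (hne : F.restrict (stage Γ F dep k) ≠ F) :
    Γ.ParallelStep (F.restrict (stage Γ F dep k)) (F.restrict (stage Γ F dep (k + 1))) := by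
  have hp := h.producible_stage k
  obtain ⟨hc, hs⟩ := h.closed_and_stable hp
  obtain ⟨B₀, hB₀⟩ := h.exists_attaches hp hne
  have hmem : ∀ q, q ∈ (F.restrict (stage Γ F dep k)).dom ↔ q ∈ stage Γ F dep k := fun q =>
    ⟨fun hq => (Finset.mem_filter.1 hq).2,
      fun hq => Finset.mem_filter.2 ⟨h.stage_subset k hq, hq⟩⟩
  refine ⟨⟨B₀, hB₀⟩, fun p t => ⟨fun hpt => ?_, ?_⟩⟩
  · have hpF : p ∈ stage Γ F dep (k + 1) ∧ F.tileAt p = some t := by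
      simpa [Assembly.restrict] using hpt
    by_cases hpk : p ∈ stage Γ F dep k
    -- A tile already present survives in any attachment, and there is one because the assembly is
    -- not yet `F`.
    · obtain ⟨q, u, hq, _, _, rfl⟩ := (h.attaches_iff hc hs).1 hB₀
      refine ⟨_, hB₀, ?_⟩
      rw [Assembly.place_of_ne]
      · simp [Assembly.restrict, hpk, hpF.2]
      · rintro rfl
        simp [Assembly.restrict, hpk, hpF.2] at hq
    · refine ⟨_, (h.attaches_iff hc hs).2 ⟨p, t, ?_, hpF.2, ?_, rfl⟩, Assembly.place_self _ _ _⟩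
      · simp [Assembly.restrict, hpk]
      · have := (mem_stage_succ.1 hpF.1).resolve_left hpk
        intro q hq
        exact (hmem q).2 (this.2 q hq)
  · rintro ⟨B, hB, hBp⟩
    obtain ⟨q, u, hq, hqF, hd, rfl⟩ := (h.attaches_iff hc hs).1 hB
    by_cases hpq : p = q
    · subst hpq
      rw [Assembly.place_self] at hBp
      cases hBp
      have : p ∈ stage Γ F dep (k + 1) := mem_stage_succ.2
        (.inr ⟨Assembly.mem_dom_of_eq hqF, fun r hr => (hmem r).1 (hd r hr)⟩)
      simp [Assembly.restrict, this, hqF]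
    · rw [Assembly.place_of_ne _ _ hpq] at hBp
      have hpk := (hmem p).1 (Assembly.mem_dom_of_eq hBp)
      have : p ∈ stage Γ F dep (k + 1) := stage_mono (Nat.le_succ k) hpk
      simp [Assembly.restrict, this, hc.le p t hBp]

theorem restrict_eq (h : Γ.GrowthPlan F dep rank) {K : ℕ} (hK : ∀ p ∈ F.dom, rank p < K) :
    F.restrict (stage Γ F dep K) = F := by
  refine eq_of_dom_subset (h.closed_and_stable (h.producible_stage K)).1 fun p hp => ?_
  exact Finset.mem_filter.2 ⟨hp, h.mem_stage K p hp (hK p hp)⟩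

theorem uniquelyAssembles (h : Γ.GrowthPlan F dep rank) {K : ℕ} (hK : ∀ p ∈ F.dom, rank p < K) :
    Γ.UniquelyAssembles F := by
  have hF : Γ.Producible F := by
    have := h.producible_stage K
    rwa [h.restrict_eq hK] at this
  refine Set.eq_singleton_iff_unique_mem.2 ⟨⟨hF, h.not_attaches hF⟩, fun A hA => ?_⟩
  by_contra hne
  obtain ⟨B, hB⟩ := h.exists_attaches hA.1 hne
  exact hA.2 B hB

theorem exists_hasParallelRunTime (h : Γ.GrowthPlan F dep rank) {K : ℕ}
    (hK : ∀ p ∈ F.dom, rank p < K) : ∃ k ≤ K, Γ.HasParallelRunTime k := by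
  classical
  have hex : ∃ k, F.restrict (stage Γ F dep k) = F := ⟨K, h.restrict_eq hK⟩
  -- At the first complete stage the run is over; all earlier stages are incomplete, so each of
  -- their steps is a genuine one.
  refine ⟨Nat.find hex, Nat.find_min' hex (h.restrict_eq hK),
    fun k => F.restrict (stage Γ F dep k), h.restrict_seed,
    fun i hi => h.parallelStep i (Nat.find_min hex hi), ?_⟩
  simp only [Nat.find_spec hex]
  exact h.uniquelyAssembles hK

end GrowthPlan

end TileSystem

theorem TAC.exists_hasWorstCaseRunTime {G : Type} {n k : ℕ} (I : TAC G n k) {K : ℕ}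
    (h : ∀ b, ∃ l ≤ K, (I.system b).HasParallelRunTime l) :
    ∃ w ≤ K, I.HasWorstCaseRunTime w := by
  choose l hl hrun using h
  obtain ⟨b, -, hb⟩ := Finset.exists_max_image Finset.univ l ⟨fun _ => false, Finset.mem_univ _⟩
  exact ⟨l b, hl b, fun c => ⟨l c, hb c (Finset.mem_univ c), hrun c⟩, b, hrun b⟩

end TileAssembly

/-! ### Glues and tiles of the adder -/

namespace TileAssembly

namespace Adder

/-- The glues of the adder. Glue `z` binds the frame and the input bits. -/
inductive Glue
  | z
  | q (p m : Option Bool)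
  | inp (c : Bool)
  | sym (o : Option (Option Bool × Bool))
  | r (c m : Bool)
  | u (c : Bool)
  | o (c : Bool)
  | pair (c d : Bool)
  | car (k : ℕ) (c : Bool)

namespace Glue

/-- The strengths of the glues. -/
def str : Glue → ℕ
  | z | u _ | o _ | pair _ _ => 2
  | car k _ => if k = 3 then 1 else 2
  | q _ _ | inp _ | sym _ | r _ _ => 1

/-- The face through which a tile receives the value of a glue. -/
def inDir : Glue → Option Dir
  | z => none
  | q _ _ | o _ => some .w
  | r _ _ => some .e
  | inp _ | sym _ | u _ | pair _ _ | car _ _ => some .s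

theorem str_pos (g : Glue) : 0 < g.str := by
  cases g <;> simp only [str] <;> first | omega | split_ifs <;> omega

/-- On the face `d`, the glue `g` is never exposed to an empty position. -/
def Inward (d : Dir) (g : Glue) : Prop :=
  g.inDir = none ∨ g.inDir = some d

end Glue

/-- The carry function of a sequence of digits that is followed by the bits `a` and `b`: `none`
stands for the identity and `some c` for the constant `c`. -/
def carryStep (p : Option Bool) (a b : Bool) : Option Bool :=
  if a = b then some a else p

/-- The tiles of the adder. -/
inductive Kind
  | bit (c : Bool)
  | pad (c : Bool)
  | frame (n e s w : Bool)
  | start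
  | zeroCarry
  | pass (p m : Option Bool) (c : Bool)
  | ret (c m : Bool) (o : Option (Option Bool × Bool))
  | conn (c : Bool)
  | merge (p : Option Bool) (c : Bool)
  | turn (c d : Bool)
  | climb (k : Fin 3) (c : Bool)
  deriving Fintype

open Glue in
/-- The tile type of a kind of tile. -/
def Kind.tile : Kind → TileType Glue
  -- Input and output share this tile: as an input it hangs on `z`, as an output it is attached
  -- through `o c` on its west face.
  | bit c => ⟨some (inp c), none, some z, some (o c), bitLabel c⟩
  | pad c => ⟨some (inp c), none, some z, none, [2]⟩
  | frame n e s w => ⟨if n then some z else none, if e then some z else none,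
      if s then some z else none, if w then some z else none, [2]⟩
  | start => ⟨some z, some (q none none), some z, none, [2]⟩
  | zeroCarry => ⟨some (car 2 false), none, none, some z, [2]⟩
  | pass p none c => ⟨some (sym none), some (q p (some c)), some (inp c), some (q p none), [2]⟩
  | pass p (some a) c => ⟨some (sym (some (p, a ^^ c))), some (q (carryStep p a c) none),
      some (inp c), some (q p (some a)), [2]⟩
  | ret c m none => ⟨some (u m), some (r c m), some (sym none), some (r c false), [2]⟩
  | ret c m (some (p, x)) => ⟨none, some (r c m), some (sym (some (p, x))),
      some (r c (x ^^ p.getD c)), [2]⟩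
  | conn c => ⟨none, some (o c), some (u c), none, [2]⟩
  | merge p c => ⟨some (pair c (p.getD c)), none, some (car 3 c), some (q p none), [2]⟩
  | turn c d => ⟨some (car 0 d), none, some (pair c d), some (r c false), [2]⟩
  | climb k c => ⟨some (car (k + 1) c), none, some (car k c), none, [2]⟩

/-- The tile set of the adder. -/
noncomputable def tileSet : TileSet Glue where
  tiles := (Set.finite_range Kind.tile).toFinset
  str := Glue.str

theorem mem_tiles {t : TileType Glue} : t ∈ tileSet.tiles ↔ ∃ k : Kind, k.tile = t := by
  simp [tileSet]

theorem label_eq_bitLabel {k : Kind} {c : Bool} (h : k.tile.label = bitLabel c) : k = .bit c := by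
  rcases k with _ | _ | _ | _ | _ | ⟨_, _ | _, _⟩ | ⟨_, _, _ | _⟩ | _ | _ | _ | _ <;> cases c <;>
    simp_all [Kind.tile, bitLabel]

/-- The strength of the glue of a tile on the face `d`, if it receives a value through it. -/
def Kind.weight (k : Kind) (d : Dir) : ℕ :=
  match k.tile.face d with
  | none => 0
  | some g => if g.inDir = some d then g.str else 0

theorem Kind.weight_of {k : Kind} {d : Dir} {g : Glue} (h : k.tile.face d = some g)
    (hg : g.inDir = some d) : k.weight d = g.str := by
  simp [weight, h, hg]

/-- Either one input of strength 2 or two of strength 1; the kinds that occur in the seed only have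
no input. -/
theorem Kind.sum_weight (k : Kind) : ∑ d, k.weight d = match k with
    | pad _ | frame _ _ _ _ | start | zeroCarry => 0
    | _ => 2 := by
  rw [Dir.sum_univ]
  rcases k with _ | _ | ⟨_ | _, _ | _, _ | _, _ | _⟩ | _ | _ | ⟨_, _ | _, _⟩ | ⟨_, _, _ | _⟩ | _ |
    _ | _ | ⟨k, _⟩
  case climb => fin_cases k <;> rfl
  all_goals rfl

/-- A bond through a face where the tile does not read its glue would need a neighbour that presents
the glue on a guarded face. This excludes growth against the flow of information. -/
theorem Kind.inDir_of_face {k : Kind} {d : Dir} {g : Glue} (h : k.tile.face d = some g) :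
    g.inDir = some d ∨ g.Inward d.opp := by
  rcases k with _ | _ | ⟨_ | _, _ | _, _ | _, _ | _⟩ | _ | _ | ⟨_, _ | _, _⟩ | ⟨_, _, _ | _⟩ | _ |
    _ | _ | ⟨k, _⟩ <;> cases d <;> simp [tile, TileType.face] at h <;> subst h <;>
    simp [Glue.Inward, Glue.inDir, Dir.opp]

/-! ### The final assembly as a relation between positions and tiles -/

/-- The bits that are written in a square array of `s` blocks of `s` columns, together with the
carries: `pre B j` is the carry function of the first `j` columns of block `B`, and `carry B` the
carry into this block. -/
structure Layout where
  s : ℤ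
  s_pos : 0 < s
  inp : ℤ → ℤ → Bool
  real : ℤ → ℤ → Prop
  pre : ℤ → ℤ → Option Bool
  carry : ℤ → Bool
  pre_zero : ∀ B, pre B 0 = none
  pre_succ : ∀ B j, 0 ≤ B → B < s → 0 ≤ j → j < s →
    pre B (j + 1) = carryStep (pre B j) (inp B (2 * j)) (inp B (2 * j + 1))
  carry_zero : carry 0 = false
  carry_succ : ∀ B, 0 ≤ B → B < s → carry (B + 1) = (pre B s).getD (carry B)

namespace Layout

variable (L : Layout)

/-- The sum bit in column `j` of block `B`. -/
def sum (B j : ℤ) : Bool :=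
  (L.inp B (2 * j) ^^ L.inp B (2 * j + 1)) ^^ (L.pre B j).getD (L.carry B)

/-- The kind of tile at each position of the final assembly. The first argument tells whether the
position belongs to the seed. -/
inductive Cell : Bool → ℤ → ℤ → Kind → Prop
  | spine {x y : ℤ} : x = -1 → 0 ≤ y → y < 5 * L.s → y % 5 ≠ 2 →
      Cell true x y (.frame (decide (y + 1 < 5 * L.s)) (decide (y % 5 = 0)) (decide (0 < y)) false)
  | start {x y : ℤ} (B : ℤ) : x = -1 → y = 5 * B + 2 → 0 ≤ B → B < L.s → Cell true x y .start
  | row {x y : ℤ} (B : ℤ) : y = 5 * B → 0 ≤ B → B < L.s → 0 ≤ x → x < 2 * L.s →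
      Cell true x y (.frame true (decide (x + 1 < 2 * L.s ∨ B = 0)) false true)
  | zeroCarry {x y : ℤ} : x = 2 * L.s → y = 0 → Cell true x y .zeroCarry
  | bit {x y : ℤ} (B : ℤ) : y = 5 * B + 1 → 0 ≤ B → B < L.s → 0 ≤ x → x < 2 * L.s → L.real B x →
      Cell true x y (.bit (L.inp B x))
  | pad {x y : ℤ} (B : ℤ) : y = 5 * B + 1 → 0 ≤ B → B < L.s → 0 ≤ x → x < 2 * L.s → ¬ L.real B x →
      Cell true x y (.pad (L.inp B x))
  | passA {x y : ℤ} (B j : ℤ) : x = 2 * j → y = 5 * B + 2 → 0 ≤ B → B < L.s → 0 ≤ j → j < L.s →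
      Cell false x y (.pass (L.pre B j) none (L.inp B (2 * j)))
  | passB {x y : ℤ} (B j : ℤ) : x = 2 * j + 1 → y = 5 * B + 2 → 0 ≤ B → B < L.s → 0 ≤ j →
      j < L.s → Cell false x y (.pass (L.pre B j) (some (L.inp B (2 * j))) (L.inp B (2 * j + 1)))
  | retB {x y : ℤ} (B j : ℤ) : x = 2 * j + 1 → y = 5 * B + 3 → 0 ≤ B → B < L.s → 0 ≤ j →
      j < L.s → Cell false x y
        (.ret (L.carry B) false (some (L.pre B j, L.inp B (2 * j) ^^ L.inp B (2 * j + 1))))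
  | retA {x y : ℤ} (B j : ℤ) : x = 2 * j → y = 5 * B + 3 → 0 ≤ B → B < L.s → 0 ≤ j → j < L.s →
      Cell false x y (.ret (L.carry B) (L.sum B j) none)
  | conn {x y : ℤ} (B j : ℤ) : x = 2 * j → y = 5 * B + 4 → 0 ≤ B → B < L.s → 0 ≤ j → j < L.s →
      Cell false x y (.conn (L.sum B j))
  | out {x y : ℤ} (B j : ℤ) : x = 2 * j + 1 → y = 5 * B + 4 → 0 ≤ B → B < L.s → 0 ≤ j → j < L.s →
      Cell false x y (.bit (L.sum B j))
  | merge {x y : ℤ} (B : ℤ) : x = 2 * L.s → y = 5 * B + 2 → 0 ≤ B → B < L.s →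
      Cell false x y (.merge (L.pre B L.s) (L.carry B))
  | turn {x y : ℤ} (B : ℤ) : x = 2 * L.s → y = 5 * B + 3 → 0 ≤ B → B < L.s →
      Cell false x y (.turn (L.carry B) (L.carry (B + 1)))
  | climb {x y : ℤ} (B : ℤ) (k : Fin 3) : x = 2 * L.s → y = 5 * B - 1 + (k : ℕ) → 0 ≤ B →
      B ≤ L.s → 0 < B ∨ (k : ℕ) = 2 → Cell false x y (.climb k (L.carry B))

variable {L}

/-- The row modulo 5, the range and parity of `x`, and `real` separate the clauses; block and column
are determined by the position. -/
theorem Cell.unique {b b' : Bool} {x y : ℤ} {k k' : Kind} (h : L.Cell b x y k)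
    (h' : L.Cell b' x y k') : b = b' ∧ k = k' := by
  have hs := L.s_pos
  cases h <;> cases h' <;> first | (exfalso; omega) | skip
  case climb.climb B k _ _ _ _ _ B' k' _ _ _ _ _ =>
    obtain rfl : B = B' := by omega
    obtain rfl : k = k' := by
      apply Fin.ext
      omega
    exact ⟨rfl, rfl⟩
  case bit.pad B _ _ _ _ _ _ B' _ _ _ _ _ _ | pad.bit B _ _ _ _ _ _ B' _ _ _ _ _ _ =>
    obtain rfl : B = B' := by omega
    exact absurd ‹L.real B x› ‹¬ L.real B x›
  all_goals refine ⟨rfl, ?_⟩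
  all_goals first | rfl | skip
  case row.row B _ _ _ _ _ B' _ _ _ _ _ | bit.bit B _ _ _ _ _ _ B' _ _ _ _ _ _ |
      pad.pad B _ _ _ _ _ _ B' _ _ _ _ _ _ | merge.merge B _ _ _ _ B' _ _ _ _ |
      turn.turn B _ _ _ _ B' _ _ _ _ =>
    obtain rfl : B = B' := by omega
    rfl
  case passA.passA B j _ _ _ _ _ _ B' j' _ _ _ _ _ _ |
      passB.passB B j _ _ _ _ _ _ B' j' _ _ _ _ _ _ |
      retA.retA B j _ _ _ _ _ _ B' j' _ _ _ _ _ _ |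
      retB.retB B j _ _ _ _ _ _ B' j' _ _ _ _ _ _ |
      conn.conn B j _ _ _ _ _ _ B' j' _ _ _ _ _ _ |
      out.out B j _ _ _ _ _ _ B' j' _ _ _ _ _ _ =>
    obtain rfl : B = B' := by omega
    obtain rfl : j = j' := by omega
    rfl

theorem Cell.bounds {b : Bool} {x y : ℤ} {k : Kind} (h : L.Cell b x y k) :
    -1 ≤ x ∧ x ≤ 2 * L.s ∧ 0 ≤ y ∧ y ≤ 5 * L.s + 1 := by
  have hs := L.s_pos
  cases h <;> omega

variable (L)

open Classical in
/-- The final assembly. -/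
noncomputable def final : Assembly Glue where
  tileAt := fun p => if h : ∃ k b, L.Cell b p.1 p.2 k then some h.choose.tile else none
  dom := (Finset.Icc (-1) (2 * L.s) ×ˢ Finset.Icc 0 (5 * L.s + 1)).filter
    fun p => ∃ k b, L.Cell b p.1 p.2 k
  mem_dom := by
    rintro ⟨x, y⟩
    by_cases h : ∃ k b, L.Cell b x y k
    · have hb := h.choose_spec.choose_spec.bounds
      simp only [Finset.mem_filter, Finset.mem_product, Finset.mem_Icc, dif_pos h]
      exact ⟨fun _ => Option.some_ne_none _, fun _ => ⟨⟨⟨hb.1, hb.2.1⟩, hb.2.2⟩, h⟩⟩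
    · simp only [Finset.mem_filter, dif_neg h, ne_eq, not_true, iff_false]
      exact fun h' => h h'.2

open Classical in
/-- The positions of the seed. -/
noncomputable def seedDom : Finset (ℤ × ℤ) :=
  L.final.dom.filter fun p => ∃ k, L.Cell true p.1 p.2 k

variable {L}

theorem Cell.tileAt {b : Bool} {x y : ℤ} {k : Kind} (h : L.Cell b x y k) :
    L.final.tileAt (x, y) = some k.tile := by
  have h' : ∃ k b, L.Cell b x y k := ⟨k, b, h⟩
  have hk : h'.choose = k := (h'.choose_spec.choose_spec.unique h).2
  simp only [final, dif_pos h', hk]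

theorem final_eq_some {p : ℤ × ℤ} {t : TileType Glue} (h : L.final.tileAt p = some t) :
    ∃ b k, L.Cell b p.1 p.2 k ∧ t = k.tile := by
  simp only [final] at h
  split_ifs at h with h'
  exact ⟨h'.choose_spec.choose, h'.choose, h'.choose_spec.choose_spec, (Option.some.inj h).symm⟩

theorem Cell.mem_dom {b : Bool} {x y : ℤ} {k : Kind} (h : L.Cell b x y k) :
    (x, y) ∈ L.final.dom :=
  Assembly.mem_dom_of_eq h.tileAt

theorem mem_seedDom {p : ℤ × ℤ} : p ∈ L.seedDom ↔ ∃ k, L.Cell true p.1 p.2 k := by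
  classical
  exact ⟨fun h => (Finset.mem_filter.1 h).2,
    fun h => Finset.mem_filter.2 ⟨h.choose_spec.mem_dom, h⟩⟩

end Layout

end Adder

end TileAssembly

/-! ### Local analysis: what a glue says about its position -/

namespace TileAssembly

namespace Adder

namespace Layout

variable {L : Layout}

open Glue

/-- The entry `m` tells the two halves of a column apart: it holds the first digit while the second
is awaited. -/
theorem Cell.of_east_q {b : Bool} {x y : ℤ} {k : Kind} (h : L.Cell b x y k) {p m : Option Bool}
    (hg : k.tile.face .e = some (q p m)) :
    ∃ B j, y = 5 * B + 2 ∧ 0 ≤ B ∧ B < L.s ∧ 0 ≤ j ∧ p = L.pre B j ∧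
      (j ≤ L.s ∧ x = 2 * j - 1 ∧ m = none ∨ j < L.s ∧ x = 2 * j ∧ m = some (L.inp B (2 * j))) := by
  have hs := L.s_pos
  cases h <;> simp [Kind.tile, TileType.face] at hg
  case start B _ _ _ _ =>
    obtain ⟨rfl, rfl⟩ := hg
    exact ⟨B, 0, by omega, by omega, by omega, le_rfl, (L.pre_zero B).symm,
      .inl ⟨by omega, by omega, rfl⟩⟩
  case passA B j _ _ _ _ _ _ =>
    obtain ⟨rfl, rfl⟩ := hg
    exact ⟨B, j, by omega, by omega, by omega, by omega, rfl, .inr ⟨by omega, by omega, rfl⟩⟩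
  case passB B j hB hB' hj hj' _ _ =>
    obtain ⟨rfl, rfl⟩ := hg
    exact ⟨B, j + 1, by omega, by omega, by omega, by omega, (L.pre_succ B j hB hB' hj hj').symm,
      .inl ⟨by omega, by omega, rfl⟩⟩

/-- Output tiles present `inp` as well. Their value is not recorded, since no `q` arrives in the row
above them. -/
theorem Cell.of_north_inp {b : Bool} {x y : ℤ} {k : Kind} (h : L.Cell b x y k) {c : Bool}
    (hg : k.tile.face .n = some (Glue.inp c)) :
    ∃ B, 0 ≤ B ∧ B < L.s ∧ 0 ≤ x ∧ x < 2 * L.s ∧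
      (y = 5 * B + 1 ∧ c = L.inp B x ∨ y = 5 * B + 4) := by
  cases h <;> simp [Kind.tile, TileType.face] at hg
  case bit B _ _ _ _ _ _ =>
    exact ⟨B, by omega, by omega, by omega, by omega, .inl ⟨by omega, hg.symm⟩⟩
  case pad B _ _ _ _ _ _ =>
    exact ⟨B, by omega, by omega, by omega, by omega, .inl ⟨by omega, hg.symm⟩⟩
  case out B j _ _ _ _ _ _ =>
    exact ⟨B, by omega, by omega, by omega, by omega, .inr (by omega)⟩

theorem Cell.of_north_sym {b : Bool} {x y : ℤ} {k : Kind} (h : L.Cell b x y k)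
    {o : Option (Option Bool × Bool)} (hg : k.tile.face .n = some (sym o)) :
    ∃ B j, y = 5 * B + 2 ∧ 0 ≤ B ∧ B < L.s ∧ 0 ≤ j ∧ j < L.s ∧ (x = 2 * j ∧ o = none ∨
      x = 2 * j + 1 ∧ o = some (L.pre B j, L.inp B (2 * j) ^^ L.inp B (2 * j + 1))) := by
  cases h <;> simp [Kind.tile, TileType.face] at hg
  case passA B j _ _ _ _ _ _ =>
    exact ⟨B, j, by omega, by omega, by omega, by omega, by omega, .inl ⟨by omega, hg.symm⟩⟩
  case passB B j _ _ _ _ _ _ =>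
    exact ⟨B, j, by omega, by omega, by omega, by omega, by omega, .inr ⟨by omega, hg.symm⟩⟩

theorem Cell.of_west_r {b : Bool} {x y : ℤ} {k : Kind} (h : L.Cell b x y k) {c m : Bool}
    (hg : k.tile.face .w = some (r c m)) :
    ∃ B j, y = 5 * B + 3 ∧ c = L.carry B ∧
      (x = 2 * j ∧ m = false ∨ x = 2 * j + 1 ∧ m = L.sum B j) := by
  cases h <;> simp [Kind.tile, TileType.face] at hg
  case retA B j _ _ _ _ _ _ => exact ⟨B, j, by omega, hg.1.symm, .inl ⟨by omega, hg.2⟩⟩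
  case retB B j _ _ _ _ _ _ =>
    exact ⟨B, j, by omega, hg.1.symm, .inr ⟨by omega, by simp [Layout.sum, ← hg.2]⟩⟩
  case turn B _ _ _ _ => exact ⟨B, L.s, by omega, hg.1.symm, .inl ⟨by omega, hg.2⟩⟩

theorem Cell.of_north_u {b : Bool} {x y : ℤ} {k : Kind} (h : L.Cell b x y k) {c : Bool}
    (hg : k.tile.face .n = some (u c)) :
    ∃ B j, y = 5 * B + 3 ∧ 0 ≤ B ∧ B < L.s ∧ 0 ≤ j ∧ j < L.s ∧ x = 2 * j ∧ c = L.sum B j := by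
  cases h <;> simp [Kind.tile, TileType.face] at hg
  case retA B j _ _ _ _ _ _ =>
    exact ⟨B, j, by omega, by omega, by omega, by omega, by omega, by omega, hg.symm⟩

theorem Cell.of_east_o {b : Bool} {x y : ℤ} {k : Kind} (h : L.Cell b x y k) {c : Bool}
    (hg : k.tile.face .e = some (o c)) :
    ∃ B j, y = 5 * B + 4 ∧ 0 ≤ B ∧ B < L.s ∧ 0 ≤ j ∧ j < L.s ∧ x = 2 * j ∧ c = L.sum B j := by
  cases h <;> simp [Kind.tile, TileType.face] at hg
  case conn B j _ _ _ _ _ _ =>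
    exact ⟨B, j, by omega, by omega, by omega, by omega, by omega, by omega, hg.symm⟩

theorem Cell.of_north_pair {b : Bool} {x y : ℤ} {k : Kind} (h : L.Cell b x y k) {c d : Bool}
    (hg : k.tile.face .n = some (pair c d)) :
    ∃ B, x = 2 * L.s ∧ y = 5 * B + 2 ∧ 0 ≤ B ∧ B < L.s ∧ c = L.carry B ∧ d = L.carry (B + 1) := by
  cases h <;> simp [Kind.tile, TileType.face] at hg
  case merge B hB hB' _ _ =>
    exact ⟨B, by omega, by omega, by omega, by omega, hg.1.symm,
      by rw [L.carry_succ B hB hB', hg.2]⟩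

/-- The counter of `car` fixes the height within the block. The first carry enters with counter 2,
because no block lies below it. -/
theorem Cell.of_north_car {b : Bool} {x y : ℤ} {k : Kind} (h : L.Cell b x y k) {i : ℕ} {c : Bool}
    (hg : k.tile.face .n = some (car i c)) :
    ∃ B, x = 2 * L.s ∧ y = 5 * B - 2 + i ∧ 0 ≤ B ∧ B ≤ L.s ∧ (0 < B ∨ 2 ≤ i) ∧
      c = L.carry B := by
  have hs := L.s_pos
  cases h <;> simp [Kind.tile, TileType.face] at hg
  case zeroCarry =>
    exact ⟨0, by omega, by omega, by omega, by omega, by omega, by rw [L.carry_zero, ← hg.2]⟩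
  case turn B _ _ _ _ =>
    exact ⟨B + 1, by omega, by omega, by omega, by omega, by omega, hg.2.symm⟩
  case climb B k _ _ _ _ _ =>
    exact ⟨B, by omega, by omega, by omega, by omega, by omega, hg.2.symm⟩

/-- A tile whose inputs are all presented by the final assembly belongs to it. -/
theorem Cell.of_inputs {x y : ℤ} {k : Kind} (h0 : ∃ d, 0 < k.weight d)
    (h : ∀ d g, k.tile.face d = some g → g.inDir = some d → ∃ b k',
      L.Cell b (d.move (x, y)).1 (d.move (x, y)).2 k' ∧ k'.tile.face d.opp = some g) :
    ∃ b, L.Cell b x y k := by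
  have h1 : 0 < ∑ d, k.weight d := by
    obtain ⟨d, hd⟩ := h0
    exact hd.trans_le (Finset.single_le_sum (f := k.weight) (fun _ _ => Nat.zero_le _)
      (Finset.mem_univ d))
  rw [Kind.sum_weight] at h1
  rcases k with c | _ | _ | _ | _ | ⟨p, m, c⟩ | ⟨c, m, _ | ⟨p, x'⟩⟩ | c | ⟨p, c⟩ | ⟨c, d⟩ | ⟨i, c⟩ <;>
    simp only [lt_irrefl] at h1
  case bit =>
    obtain ⟨_, _, hw, hwg⟩ := h .w (o c) rfl rfl
    obtain ⟨B, j, hy, hB, hB', hj, hj', hx, rfl⟩ := hw.of_east_o hwg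
    simp only [Dir.move] at hx hy
    exact ⟨_, .out B j (by omega) (by omega) hB hB' hj hj'⟩
  case pass =>
    obtain ⟨_, _, hw, hwg⟩ := h .w (q p m) (by cases m <;> rfl) rfl
    obtain ⟨_, _, hn, hng⟩ := h .s (Glue.inp c) (by cases m <;> rfl) rfl
    obtain ⟨B, j, hy, hB, hB', hj, rfl, hq⟩ := hw.of_east_q hwg
    obtain ⟨B', _, _, _, hx, hc⟩ := hn.of_north_inp hng
    simp only [Dir.move] at hq hx hy hc
    rcases hc with ⟨hy', rfl⟩ | hy'
    · obtain rfl : B' = B := by omega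
      rcases hq with ⟨_, hx', rfl⟩ | ⟨_, hx', rfl⟩
      · obtain rfl : x = 2 * j := by omega
        exact ⟨_, .passA B' j rfl (by omega) hB hB' hj (by omega)⟩
      · obtain rfl : x = 2 * j + 1 := by omega
        exact ⟨_, .passB B' j rfl (by omega) hB hB' hj (by omega)⟩
    -- An `inp` from an output row would put this tile in row 0 modulo 5, whereas `q` puts it in row
    -- 2.
    · omega
  case ret.none =>
    obtain ⟨_, _, hw, hwg⟩ := h .e (r c m) rfl rfl
    obtain ⟨_, _, hn, hng⟩ := h .s (sym none) rfl rfl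
    obtain ⟨B, j, hy, rfl, hx⟩ := hw.of_west_r hwg
    obtain ⟨B', j', hy', hB, hB', hj, hj', hx'⟩ := hn.of_north_sym hng
    simp only [Dir.move, reduceCtorEq, and_false, or_false, and_true] at hy hy' hx hx'
    obtain rfl : B' = B := by omega
    rcases hx with ⟨hx, -⟩ | ⟨hx, rfl⟩
    · omega
    · obtain rfl : j' = j := by omega
      exact ⟨_, .retA B' j' hx' (by omega) hB hB' hj hj'⟩
  case ret.some =>
    obtain ⟨_, _, hw, hwg⟩ := h .e (r c m) rfl rfl
    obtain ⟨_, _, hn, hng⟩ := h .s (sym (some (p, x'))) rfl rfl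
    obtain ⟨B, j, hy, rfl, hx⟩ := hw.of_west_r hwg
    obtain ⟨B', j', hy', hB, hB', hj, hj', hx'⟩ := hn.of_north_sym hng
    simp only [Dir.move, reduceCtorEq, and_false, false_or, Option.some.injEq,
      Prod.mk.injEq] at hy hy' hx hx'
    obtain rfl : B' = B := by omega
    obtain ⟨hx', rfl, rfl⟩ := hx'
    rcases hx with ⟨hx, rfl⟩ | ⟨hx, -⟩
    · exact ⟨_, .retB B' j' hx' (by omega) hB hB' hj hj'⟩
    · omega
  case conn =>
    obtain ⟨_, _, hn, hng⟩ := h .s (u c) rfl rfl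
    obtain ⟨B, j, hy, hB, hB', hj, hj', hx, rfl⟩ := hn.of_north_u hng
    simp only [Dir.move] at hx hy
    exact ⟨_, .conn B j (by omega) (by omega) hB hB' hj hj'⟩
  case merge =>
    obtain ⟨_, _, hw, hwg⟩ := h .w (q p none) rfl rfl
    obtain ⟨_, _, hn, hng⟩ := h .s (car 3 c) rfl rfl
    obtain ⟨B, j, hy, hB, hB', hj, rfl, hq⟩ := hw.of_east_q hwg
    obtain ⟨B', hx, hy', _, _, _, rfl⟩ := hn.of_north_car hng
    simp only [Dir.move] at hq hx hy hy'
    obtain rfl : B' = B := by omega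
    obtain rfl : j = L.s := by omega
    exact ⟨_, .merge B' hx (by omega) hB hB'⟩
  case turn =>
    obtain ⟨_, _, hn, hng⟩ := h .s (pair c d) rfl rfl
    obtain ⟨B, hx, hy, hB, hB', rfl, rfl⟩ := hn.of_north_pair hng
    simp only [Dir.move] at hx hy
    exact ⟨_, .turn B hx (by omega) hB hB'⟩
  case climb =>
    obtain ⟨_, _, hn, hng⟩ := h .s (car i c) rfl rfl
    obtain ⟨B, hx, hy, hB, hB', hi, rfl⟩ := hn.of_north_car hng
    simp only [Dir.move] at hx hy
    exact ⟨_, .climb B i hx (by omega) hB hB' (by omega)⟩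

theorem exists_input {x y : ℤ} (B : ℤ) (hy : y = 5 * B + 1) (hB : 0 ≤ B) (hB' : B < L.s)
    (hx : 0 ≤ x) (hx' : x < 2 * L.s) :
    ∃ k, L.Cell true x y k ∧ k.tile.face .n = some (Glue.inp (L.inp B x)) := by
  by_cases hr : L.real B x
  · exact ⟨_, .bit B hy hB hB' hx hx' hr, rfl⟩
  · exact ⟨_, .pad B hy hB hB' hx hx' hr, rfl⟩

/-- An upper bound on the number of the parallel step that fills a position. -/
def rank (L : Layout) (p : ℤ × ℤ) : ℕ :=
  Int.toNat (if p.2 % 5 = 2 ∧ p.1 < 2 * L.s then p.1 + 1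
    -- An output tile comes after its western neighbour, against the westward order of the returning
    -- row; the 2 makes up for this.
    else if p.2 % 5 = 4 ∧ p.1 % 2 = 1 then 4 * L.s + p.2 - p.1 + 2
    else 4 * L.s + p.2 - p.1)

/-- The matching glue is needed for completeness, the rank for the run time. The only guarded face
of a grown tile that is not an input is the south face of an output tile, where occupancy is enough.
-/
theorem Cell.exists_source {x y : ℤ} {k : Kind} (h : L.Cell false x y k) {d : Dir} {g : Glue}
    (hg : k.tile.face d = some g) (hd : g.Inward d) :
    ∃ b k', L.Cell b (d.move (x, y)).1 (d.move (x, y)).2 k' ∧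
      (g.inDir = some d → k'.tile.face d.opp = some g) ∧
      (b = true ∨ L.rank (d.move (x, y)) < L.rank (x, y)) := by
  have hs := L.s_pos
  cases h <;> cases d <;> simp [Kind.tile, TileType.face] at hg <;> subst hg <;>
    simp [Inward, inDir] at hd <;> simp only [Dir.move, Dir.opp]
  case passA.w B j hB hB' hj hj' hx hy =>
    obtain rfl | hj0 := hj.eq_or_lt
    · exact ⟨_, _, .start B (by omega) hy hB hB', fun _ => by rw [L.pre_zero]; rfl, .inl rfl⟩
    · refine ⟨_, _, .passB B (j - 1) (by omega) hy hB hB' (by omega) (by omega), fun _ => ?_,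
        .inr (by simp only [rank]; split_ifs <;> omega)⟩
      have := L.pre_succ B (j - 1) hB hB' (by omega) (by omega)
      rw [sub_add_cancel] at this
      rw [this]
      rfl
  case passA.s B j hB hB' hj hj' hx hy =>
    obtain ⟨k, hk, hkg⟩ := L.exists_input (x := x) (y := y - 1) B (by omega) hB hB' (by omega)
      (by omega)
    subst hx
    exact ⟨_, k, hk, fun _ => hkg, .inl rfl⟩
  case passB.w B j hB hB' hj hj' hx hy =>
    exact ⟨_, _, .passA B j (by omega) hy hB hB' hj hj', fun _ => rfl,
      .inr (by simp only [rank]; split_ifs <;> omega)⟩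
  case passB.s B j hB hB' hj hj' hx hy =>
    obtain ⟨k, hk, hkg⟩ := L.exists_input (x := x) (y := y - 1) B (by omega) hB hB' (by omega)
      (by omega)
    subst hx
    exact ⟨_, k, hk, fun _ => hkg, .inl rfl⟩
  case retB.e B j hB hB' hj hj' hx hy =>
    by_cases hjs : j + 1 = L.s
    · exact ⟨_, _, .turn B (by omega) hy hB hB', fun _ => rfl,
        .inr (by simp only [rank]; split_ifs <;> omega)⟩
    · exact ⟨_, _, .retA B (j + 1) (by omega) hy hB hB' (by omega) (by omega), fun _ => rfl,
        .inr (by simp only [rank]; split_ifs <;> omega)⟩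
  case retB.s B j hB hB' hj hj' hx hy =>
    exact ⟨_, _, .passB B j hx (by omega) hB hB' hj hj', fun _ => rfl,
      .inr (by simp only [rank]; split_ifs <;> omega)⟩
  case retA.e B j hB hB' hj hj' hx hy =>
    exact ⟨_, _, .retB B j (by omega) hy hB hB' hj hj', fun _ => rfl,
      .inr (by simp only [rank]; split_ifs <;> omega)⟩
  case retA.s B j hB hB' hj hj' hx hy =>
    exact ⟨_, _, .passA B j hx (by omega) hB hB' hj hj', fun _ => rfl,
      .inr (by simp only [rank]; split_ifs <;> omega)⟩
  case conn.s B j hB hB' hj hj' hx hy =>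
    exact ⟨_, _, .retA B j hx (by omega) hB hB' hj hj', fun _ => rfl,
      .inr (by simp only [rank]; split_ifs <;> omega)⟩
  case out.w B j hB hB' hj hj' hx hy =>
    exact ⟨_, _, .conn B j (by omega) hy hB hB' hj hj', fun _ => rfl,
      .inr (by simp only [rank]; split_ifs <;> omega)⟩
  case out.s B j hB hB' hj hj' hx hy =>
    exact ⟨_, _, .retB B j hx (by omega) hB hB' hj hj', fun h => by simp [inDir] at h,
      .inr (by simp only [rank]; split_ifs <;> omega)⟩
  case merge.w B hB hB' hx hy =>
    refine ⟨_, _, .passB B (L.s - 1) (by omega) hy hB hB' (by omega) (by omega), fun _ => ?_,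
      .inr (by simp only [rank]; split_ifs <;> omega)⟩
    have := L.pre_succ B (L.s - 1) hB hB' (by omega) (by omega)
    rw [sub_add_cancel] at this
    rw [this]
    rfl
  case merge.s B hB hB' hx hy =>
    exact ⟨_, _, .climb B 2 hx (by simp; omega) hB hB'.le (.inr rfl), fun _ => rfl,
      .inr (by simp only [rank]; split_ifs <;> omega)⟩
  case turn.s B hB hB' hx hy =>
    exact ⟨_, _, .merge B hx (by omega) hB hB', fun _ => by rw [L.carry_succ B hB hB']; rfl,
      .inr (by simp only [rank]; split_ifs <;> omega)⟩
  case climb.s B k hB hB' hk hx hy =>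
    by_cases hB0 : B = 0
    · subst hB0
      obtain rfl : k = 2 := Fin.ext (by simpa using hk)
      exact ⟨_, _, .zeroCarry hx (by simp at hy; omega), fun _ => by rw [L.carry_zero]; rfl, .inl rfl⟩
    · obtain ⟨k, hk3⟩ := k
      rcases k with _ | k
      · refine ⟨_, _, .turn (B - 1) hx (by simp at hy; omega) (by omega) (by omega), fun _ => ?_,
          .inr (by simp only [rank]; split_ifs <;> omega)⟩
        rw [sub_add_cancel]
        rfl
      · exact ⟨_, _, .climb B ⟨k, by omega⟩ hx (by simp at hy ⊢; omega) hB hB' (.inl (by omega)),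
          fun _ => rfl, .inr (by simp only [rank]; split_ifs <;> omega)⟩

theorem exists_spine {x y : ℤ} (hx : x = -1) (hy : 0 ≤ y) (hy' : y < 5 * L.s) :
    ∃ k, L.Cell true x y k ∧ (y + 1 < 5 * L.s → k.tile.face .n = some z) ∧
      (y % 5 = 0 → k.tile.face .e = some z) ∧ (0 < y → k.tile.face .s = some z) := by
  by_cases h : y % 5 = 2
  · exact ⟨_, .start (y / 5) hx (by omega) (by omega) (by omega), fun _ => rfl, fun _ => by omega,
      fun _ => rfl⟩
  · exact ⟨_, .spine hx hy hy' h, by simp [Kind.tile, TileType.face],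
      by simp [Kind.tile, TileType.face], by simp [Kind.tile, TileType.face]⟩

/-- This makes the seed closed, so that nothing can attach to its guarded faces. -/
theorem Cell.exists_seed {x y : ℤ} {k : Kind} (h : L.Cell true x y k) {d : Dir} {g : Glue}
    (hg : k.tile.face d = some g) (hd : g.Inward d) :
    ∃ k', L.Cell true (d.move (x, y)).1 (d.move (x, y)).2 k' := by
  have hs := L.s_pos
  cases h <;> cases d <;> simp [Kind.tile, TileType.face] at hg <;> simp only [Dir.move]
  case spine.n => exact (L.exists_spine (by omega) (by omega) (by omega)).imp fun _ h => h.1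
  case spine.s => exact (L.exists_spine (by omega) (by omega) (by omega)).imp fun _ h => h.1
  case spine.e => exact ⟨_, .row (y / 5) (by omega) (by omega) (by omega) (by omega) (by omega)⟩
  case start.n => exact (L.exists_spine (by omega) (by omega) (by omega)).imp fun _ h => h.1
  case start.s => exact (L.exists_spine (by omega) (by omega) (by omega)).imp fun _ h => h.1
  case row.n B _ _ _ _ _ =>
    exact (L.exists_input B (by omega) (by omega) (by omega) (by omega) (by omega)).imp
      fun _ h => h.1
  case row.e B _ _ _ _ _ =>
    by_cases hx : x + 1 < 2 * L.s
    · exact ⟨_, .row B (by omega) (by omega) (by omega) (by omega) (by omega)⟩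
    · exact ⟨_, .zeroCarry (by omega) (by omega)⟩
  case row.w B _ _ _ _ _ =>
    by_cases hx : x = 0
    · exact (L.exists_spine (by omega) (by omega) (by omega)).imp fun _ h => h.1
    · exact ⟨_, .row B (by omega) (by omega) (by omega) (by omega) (by omega)⟩
  case zeroCarry.w => exact ⟨_, .row 0 (by omega) (by omega) (by omega) (by omega) (by omega)⟩
  case bit.s B _ _ _ _ _ _ =>
    exact ⟨_, .row B (by omega) (by omega) (by omega) (by omega) (by omega)⟩
  case pad.s B _ _ _ _ _ _ =>
    exact ⟨_, .row B (by omega) (by omega) (by omega) (by omega) (by omega)⟩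
  case bit.w B _ _ _ _ _ _ =>
    by_cases hx : x = 0
    · exact (L.exists_spine (by omega) (by omega) (by omega)).imp fun _ h => h.1
    · exact (L.exists_input B (by omega) (by omega) (by omega) (by omega) (by omega)).imp
        fun _ h => h.1
  all_goals
    subst hg
    simp [Inward, inDir] at hd

/-! ### The seed and the growth plan of the adder -/

variable (L)

/-- The seed. -/
noncomputable def seed : Assembly Glue :=
  L.final.restrict L.seedDom

/-- The tile system that adds the bits of the layout. -/
noncomputable def system : TileSystem Glue where
  tileSet := tileSet
  seed := L.seed
  temp := 2

variable {L}

theorem seed_eq_some {p : ℤ × ℤ} {t : TileType Glue} :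
    L.seed.tileAt p = some t ↔ ∃ k, L.Cell true p.1 p.2 k ∧ t = k.tile := by
  by_cases hp : p ∈ L.seedDom
  · obtain ⟨k, hk⟩ := mem_seedDom.1 hp
    simp only [seed, Assembly.restrict, if_pos hp]
    rw [hk.tileAt]
    constructor
    · rintro ⟨⟩
      exact ⟨k, hk, rfl⟩
    · rintro ⟨k', hk', rfl⟩
      rw [(hk.unique hk').2]
  · simp only [seed, Assembly.restrict, if_neg hp, reduceCtorEq, false_iff]
    rintro ⟨k, hk, -⟩
    exact hp (mem_seedDom.2 ⟨k, hk⟩)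

theorem Cell.seed_tileAt {x y : ℤ} {k : Kind} (h : L.Cell true x y k) :
    L.seed.tileAt (x, y) = some k.tile :=
  seed_eq_some.2 ⟨k, h, rfl⟩

theorem mem_seed_dom {p : ℤ × ℤ} : p ∈ L.seed.dom ↔ ∃ k, L.Cell true p.1 p.2 k := by
  constructor
  · intro h
    obtain ⟨t, ht⟩ := L.seed.exists_of_mem_dom h
    obtain ⟨k, hk, -⟩ := seed_eq_some.1 ht
    exact ⟨k, hk⟩
  · rintro ⟨k, hk⟩
    exact Assembly.mem_dom_of_eq hk.seed_tileAt

theorem stable_seed : L.seed.Stable Glue.str 2 := by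
  have hs := L.s_pos
  -- Every tile but the corner has a `z` bond to the south or west; the `+ 1` keeps the rank
  -- nonnegative on the spine `x = -1`.
  refine L.seed.stable_of_tree Glue.str 2 (fun p => (p.1 + p.2 + 1).toNat) (-1, 0) ?_
  rintro ⟨x, y⟩ hp hne
  obtain ⟨k, hk⟩ := mem_seed_dom.1 hp
  suffices h : ∃ d, (d = Dir.s ∨ d = Dir.w) ∧ k.tile.face d = some z ∧
      ∃ k', L.Cell true (d.move (x, y)).1 (d.move (x, y)).2 k' ∧
        k'.tile.face d.opp = some z by
    obtain ⟨d, hd, hkd, k', hk', hkd'⟩ := h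
    refine ⟨d.move (x, y), mem_seed_dom.2 ⟨k', hk'⟩, ?_, ?_⟩
    · have := hk'.bounds
      have := hk.bounds
      rcases hd with rfl | rfl <;> simp only [Dir.move] at * <;> omega
    · exact L.seed.str_le_bond Glue.str hk.seed_tileAt hk'.seed_tileAt hkd hkd'
  have hrow : ∀ B : ℤ, 0 ≤ B → B < L.s → 0 ≤ x → x < 2 * L.s → y - 1 = 5 * B →
      ∃ k', L.Cell true x (y - 1) k' ∧ k'.tile.face .n = some z := fun B hB hB' hx hx' hy =>
    ⟨_, .row B hy hB hB' hx hx', rfl⟩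
  simp only [Dir.move, Dir.opp] at *
  cases hk
  case spine =>
    have hy : 0 < y := by
      by_contra hy
      exact hne (Prod.ext (by dsimp only; omega) (by dsimp only; omega))
    obtain ⟨k, h1, h2, -⟩ := L.exists_spine (x := x) (y := y - 1) (by omega) (by omega) (by omega)
    exact ⟨.s, .inl rfl, by simp [Kind.tile, TileType.face, hy], k, h1, h2 (by omega)⟩
  case start =>
    obtain ⟨k, h1, h2, -⟩ := L.exists_spine (x := x) (y := y - 1) (by omega) (by omega) (by omega)
    exact ⟨.s, .inl rfl, rfl, k, h1, h2 (by omega)⟩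
  case row B _ _ _ _ _ =>
    refine ⟨.w, .inr rfl, rfl, ?_⟩
    by_cases hx : x = 0
    · obtain ⟨k, h1, -, h2, -⟩ := L.exists_spine (x := x - 1) (y := y) (by omega) (by omega)
        (by omega)
      exact ⟨k, h1, h2 (by omega)⟩
    · refine ⟨_, .row (x := x - 1) (y := y) B (by omega) (by omega) (by omega) (by omega)
        (by omega), ?_⟩
      have : x < 2 * L.s := by omega
      simp [Kind.tile, TileType.face, this]
  case zeroCarry =>
    exact ⟨.w, .inr rfl, rfl, _, .row (x := x - 1) (y := y) 0 (by omega) (by omega) (by omega) (by omega)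
      (by omega), by simp [Kind.tile, TileType.face]⟩
  case bit B _ _ _ _ _ _ =>
    exact ⟨.s, .inl rfl, rfl, hrow B (by omega) (by omega) (by omega) (by omega) (by omega)⟩
  case pad B _ _ _ _ _ _ =>
    exact ⟨.s, .inl rfl, rfl, hrow B (by omega) (by omega) (by omega) (by omega) (by omega)⟩

variable (L)

/-- The positions from which the tile at `p` receives its inputs, and those that its other guarded
faces point to. -/
def dep (p : ℤ × ℤ) : Set (ℤ × ℤ) :=
  {q | ∃ t d g, L.final.tileAt p = some t ∧ t.face d = some g ∧ g.Inward d ∧ q = d.move p}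

variable {L}

theorem mem_dom_of_inward {A : Assembly Glue} (hA : L.system.Closed L.final L.dep A)
    {p : ℤ × ℤ} {t : TileType Glue} (ht : A.tileAt p = some t) {d : Dir} {g : Glue}
    (hg : t.face d = some g) (hd : g.Inward d) : d.move p ∈ A.dom :=
  hA.dep_mem p (Assembly.mem_dom_of_eq ht) _ ⟨t, d, g, hA.le p t ht, hg, hd, rfl⟩

/-- A guarded face of a neighbour that pointed to `p` would force `p` to be occupied, so only input
faces bind. Their strengths add up to at most the temperature, hence none of them can fail to match.
-/
theorem matched_of_pull {A : Assembly Glue} (hA : L.system.Closed L.final L.dep A)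
    {p : ℤ × ℤ} (hp : A.tileAt p = none) {k : Kind} (hk : 2 ≤ A.pull Glue.str p k.tile) :
    (∃ d, 0 < k.weight d) ∧ ∀ d g, k.tile.face d = some g → g.inDir = some d →
      ∃ t, A.tileAt (d.move p) = some t ∧ t.face d.opp = some g := by
  have key : ∀ d, 0 < glueStrength Glue.str (k.tile.face d) (A.faceAt (d.move p) d.opp) →
      ∃ g t, k.tile.face d = some g ∧ g.inDir = some d ∧ A.tileAt (d.move p) = some t ∧
        t.face d.opp = some g := by
    intro d hd
    obtain ⟨g, hg, hg'⟩ := exists_of_glueStrength_pos Glue.str hd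
    obtain ⟨t, ht, htg⟩ := Option.bind_eq_some_iff.1 hg'
    rcases Kind.inDir_of_face hg with h | h
    · exact ⟨g, t, hg, h, ht, htg⟩
    · have := mem_dom_of_inward hA ht htg h
      rw [Dir.move_opp, A.mem_dom] at this
      exact absurd hp this
  have hle : ∀ d, glueStrength Glue.str (k.tile.face d) (A.faceAt (d.move p) d.opp) ≤
      k.weight d := by
    intro d
    rcases Nat.eq_zero_or_pos
      (glueStrength Glue.str (k.tile.face d) (A.faceAt (d.move p) d.opp)) with h | h
    · omega
    · obtain ⟨g, t, hg, hd, ht, htg⟩ := key d h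
      rw [Kind.weight_of hg hd, hg, Assembly.faceAt, ht, Option.bind_some, htg,
        glueStrength_self]
  have hsum : ∑ d, k.weight d ≤ 2 := by
    rw [Kind.sum_weight]
    split <;> omega
  have heq : ∀ d, glueStrength Glue.str (k.tile.face d) (A.faceAt (d.move p) d.opp) =
      k.weight d := by
    intro d
    by_contra hne
    have := Finset.sum_lt_sum (s := Finset.univ) (fun d _ => hle d)
      ⟨d, Finset.mem_univ d, lt_of_le_of_ne (hle d) hne⟩
    unfold Assembly.pull at hk
    omega
  constructor
  · by_contra! h0
    unfold Assembly.pull at hk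
    rw [Finset.sum_congr rfl fun d _ => heq d, Finset.sum_eq_zero fun d _ => by
      have := h0 d; omega] at hk
    omega
  · intro d g hg hd
    have := heq d
    rw [Kind.weight_of hg hd] at this
    obtain ⟨g', t, hg', -, ht, htg⟩ := key d (this ▸ g.str_pos)
    rw [hg] at hg'
    cases hg'
    exact ⟨t, ht, htg⟩

theorem exists_cell_of_closed {A : Assembly Glue} (hA : L.system.Closed L.final L.dep A)
    {p : ℤ × ℤ} {t : TileType Glue} (h : A.tileAt p = some t) :
    ∃ b k, L.Cell b p.1 p.2 k ∧ t = k.tile :=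
  final_eq_some (hA.le p t h)

/-- The guarded faces of a tile all of whose inputs are present point to occupied positions. -/
theorem dep_mem_of_matched {A : Assembly Glue} (hA : L.system.Closed L.final L.dep A)
    {p : ℤ × ℤ} {k : Kind} (hp : L.Cell false p.1 p.2 k)
    (h : ∀ d g, k.tile.face d = some g → g.inDir = some d → d.move p ∈ A.dom) :
    ∀ q ∈ L.dep p, q ∈ A.dom := by
  rintro q ⟨t, d, g, ht, hg, hd, rfl⟩
  have hpt : L.final.tileAt p = some k.tile := hp.tileAt
  rw [hpt] at ht
  cases ht
  rcases hd with hd | hd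
  · obtain ⟨x, y⟩ := p
    have hd' : k.tile.face d = some z := by
      cases g <;> simp [inDir] at hd
      exact hg
    cases hp <;> cases d <;> simp [Kind.tile, TileType.face] at hd'
    -- The connector needs the tile below it, and that tile needs its eastern neighbour, which is
    -- the position under the output tile.
    case out.s B j hB hB' hj hj' hx hy =>
      have h1 := h .w _ rfl rfl
      obtain ⟨t1, ht1⟩ := A.exists_of_mem_dom h1
      have hc1 : L.Cell false (x - 1) y (.conn (L.sum B j)) :=
        .conn B j (by dsimp only at hx; omega) hy hB hB' hj hj'
      have hf1 := hA.le _ _ ht1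
      rw [Dir.move, hc1.tileAt] at hf1
      cases hf1
      have h2 := mem_dom_of_inward hA ht1 (d := .s) rfl (.inr rfl)
      obtain ⟨t2, ht2⟩ := A.exists_of_mem_dom h2
      have hc2 : L.Cell false (x - 1) (y - 1) (.ret (L.carry B) (L.sum B j) none) :=
        .retA B j (by dsimp only at hx; omega) (by dsimp only at hy; omega) hB hB' hj hj'
      have hf2 := hA.le _ _ ht2
      rw [Dir.move, Dir.move, hc2.tileAt] at hf2
      cases hf2
      have h3 := mem_dom_of_inward hA ht2 (d := .e) rfl (.inr rfl)
      simpa [Dir.move] using h3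
  · exact h d g hg hd

theorem growthPlan : L.system.GrowthPlan L.final L.dep L.rank where
  valid := ⟨two_pos, stable_seed⟩
  nonempty := by
    have hs := L.s_pos
    exact ⟨(2 * L.s, 0), mem_seed_dom.2 ⟨_, .zeroCarry rfl rfl⟩⟩
  closed_seed :=
    { seed_le := fun _ _ h => h
      le := fun p t h => by
        obtain ⟨k, hk, rfl⟩ := seed_eq_some.1 h
        exact hk.tileAt
      dep_mem := by
        rintro ⟨x, y⟩ hp q ⟨t, d, g, ht, hg, hd, rfl⟩
        obtain ⟨k, hk⟩ := mem_seed_dom.1 hp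
        rw [hk.tileAt] at ht
        cases ht
        exact mem_seed_dom.2 (hk.exists_seed hg hd) }
  sound := by
    rintro A hA p hp t ht hpull
    obtain ⟨k, rfl⟩ := mem_tiles.1 ht
    obtain ⟨h0, hm⟩ := matched_of_pull hA hp hpull
    obtain ⟨b, hb⟩ : ∃ b, L.Cell b p.1 p.2 k := by
      refine Cell.of_inputs h0 fun d g hg hd => ?_
      obtain ⟨t, ht, htg⟩ := hm d g hg hd
      obtain ⟨b, k', hk', rfl⟩ := exists_cell_of_closed hA ht
      exact ⟨b, k', hk', htg⟩
    cases b with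
    | true =>
      have := hA.seed_le p _ hb.seed_tileAt
      simp [hp] at this
    | false =>
      refine ⟨hb.tileAt, dep_mem_of_matched hA hb fun d g hg hd => ?_⟩
      obtain ⟨t, ht, -⟩ := hm d g hg hd
      exact Assembly.mem_dom_of_eq ht
  complete := by
    rintro A hA p hp t ht hdep
    obtain ⟨b, k, hk, rfl⟩ := final_eq_some ht
    refine ⟨mem_tiles.2 ⟨k, rfl⟩, ?_⟩
    cases b with
    | true =>
      have := hA.seed_le p _ hk.seed_tileAt
      simp [hp] at this
    | false =>
      have hw : ∑ d, k.weight d = 2 := by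
        rw [Kind.sum_weight]
        cases hk <;> rfl
      change 2 ≤ A.pull Glue.str p k.tile
      rw [← hw]
      refine Finset.sum_le_sum fun d _ => ?_
      unfold Kind.weight
      split
      · exact Nat.zero_le _
      · rename_i g hg
        split_ifs with hd
        · obtain ⟨b, k', hk', hkg, -⟩ := hk.exists_source hg (.inr hd)
          obtain ⟨t', ht'⟩ := A.exists_of_mem_dom (hdep _ ⟨_, d, g, ht, hg, .inr hd, rfl⟩)
          have hf := hA.le _ _ ht'
          have hf' : L.final.tileAt (d.move p) = some k'.tile := hk'.tileAt
          rw [hf'] at hf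
          cases hf
          rw [hg, Assembly.faceAt, ht', Option.bind_some, hkg hd, glueStrength_self]
        · exact Nat.zero_le _
  rank_lt := by
    rintro ⟨x, y⟩ hp hps q ⟨t, d, g, ht, hg, hd, rfl⟩
    obtain ⟨b, k, hk, rfl⟩ := final_eq_some ht
    cases b with
    | true => exact absurd (mem_seed_dom.2 ⟨k, hk⟩) hps
    | false =>
      obtain ⟨b, k', hk', -, rfl | hlt⟩ := hk.exists_source hg hd
      · exact .inl (mem_seed_dom.2 ⟨k', hk'⟩)
      · exact .inr ⟨hk'.mem_dom, hlt⟩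

/-- The bounding box gives at most `4 * s + (5 * s + 1) + 1 + 2`. -/
theorem rank_lt_of_mem {p : ℤ × ℤ} (hp : p ∈ L.final.dom) : L.rank p < 9 * L.s.toNat + 5 := by
  have hs := L.s_pos
  obtain ⟨t, ht⟩ := L.final.exists_of_mem_dom hp
  obtain ⟨b, k, hk, -⟩ := final_eq_some ht
  have := hk.bounds
  simp only [rank]
  split_ifs <;> omega

end Layout

end Adder

end TileAssembly

/-! ### Carries and sums of binary numbers -/

namespace TileAssembly

namespace Adder

section Arithmetic

variable (α β : ℕ → Bool)

/-- The carry into a position in the addition of two binary numbers, least significant bit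
first. -/
def carryBit : ℕ → Bool
  | 0 => false
  | j + 1 => if α j = β j then α j else carryBit j

/-- The bits of the sum of two binary numbers. -/
def sumBit (j : ℕ) : Bool :=
  (α j ^^ β j) ^^ carryBit α β j

theorem sum_add_sum_eq (m : ℕ) :
    ∑ j ∈ Finset.range m, (α j).toNat * 2 ^ j + ∑ j ∈ Finset.range m, (β j).toNat * 2 ^ j =
      ∑ j ∈ Finset.range m, (sumBit α β j).toNat * 2 ^ j + (carryBit α β m).toNat * 2 ^ m := by
  induction m with
  | zero => simp [carryBit]
  | succ m ih =>
    -- The identity of a full adder at a single digit.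
    have h : (α m).toNat + (β m).toNat + (carryBit α β m).toNat =
        (sumBit α β m).toNat + 2 * (carryBit α β (m + 1)).toNat := by
      simp only [sumBit, carryBit]
      cases α m <;> cases β m <;> cases carryBit α β m <;> rfl
    simp only [Finset.sum_range_succ, pow_succ]
    calc _ = (∑ j ∈ Finset.range m, (α j).toNat * 2 ^ j +
          ∑ j ∈ Finset.range m, (β j).toNat * 2 ^ j) +
            ((α m).toNat + (β m).toNat) * 2 ^ m := by ring
      _ = ∑ j ∈ Finset.range m, (sumBit α β j).toNat * 2 ^ j +
          ((α m).toNat + (β m).toNat + (carryBit α β m).toNat) * 2 ^ m := by rw [ih]; ring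
      _ = _ := by rw [h]; ring

end Arithmetic

/-- The value of a numeral whose bits are given least significant bit first. -/
theorem binaryValue_eq_sum {m : ℕ} (r : Fin m → Bool) (γ : ℕ → Bool)
    (h : ∀ i, r i = γ (i.rev : ℕ)) :
    binaryValue r = ∑ j ∈ Finset.range m, (γ j).toNat * 2 ^ j := by
  rw [← Fin.sum_univ_eq_sum_range (fun j => (γ j).toNat * 2 ^ j), binaryValue,
    ← Equiv.sum_comp Fin.revPerm]
  exact Finset.sum_congr rfl fun i _ => by rw [h]; simp

/-- The bits of a numeral, least significant bit first, continued by zeros. -/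
def bitsOf {n : ℕ} (r : Fin n → Bool) (j : ℕ) : Bool :=
  if h : j < n then r (Fin.rev ⟨j, h⟩) else false

theorem bitsOf_rev {n : ℕ} (r : Fin n → Bool) (i : Fin n) : r i = bitsOf r (i.rev : ℕ) := by
  rw [bitsOf, dif_pos i.rev.isLt]
  exact congrArg r (Fin.rev_rev i).symm

/-! ### The square layout of two `n`-bit numbers -/

section Template

variable (n : ℕ)

/-- The number of blocks, and of bits in every block. -/
def side : ℕ := Nat.sqrt n + 1

theorem side_pos : 0 < side n := Nat.succ_pos _

theorem lt_side_mul_side : n < side n * side n := Nat.lt_succ_sqrt n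

/-- The case `j = n` is included because the sum has one digit more than the summands. -/
theorem div_side_lt {j : ℕ} (h : j ≤ n) : j / side n < side n :=
  Nat.div_lt_of_lt_mul (h.trans_lt (lt_side_mul_side n))

variable {n}

/-- The first summand. -/
def fstBits (b : Fin (n + n) → Bool) : ℕ → Bool := bitsOf fun i => b (Fin.castAdd n i)

/-- The second summand. -/
def sndBits (b : Fin (n + n) → Bool) : ℕ → Bool := bitsOf fun i => b (Fin.natAdd n i)

/-- The bit below position `x` of block `B`. -/
def inpBit (b : Fin (n + n) → Bool) (B x : ℤ) : Bool :=
  if x % 2 = 0 then fstBits b (B * side n + x / 2).toNat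
  else sndBits b (B * side n + x / 2).toNat

/-- The carry function of the first columns of a block. -/
def prefixCarry (b : Fin (n + n) → Bool) (B : ℤ) : ℕ → Option Bool
  | 0 => none
  | j + 1 => carryStep (prefixCarry b B j) (inpBit b B (2 * j)) (inpBit b B (2 * j + 1))

theorem inpBit_fst (b : Fin (n + n) → Bool) (B j : ℕ) :
    inpBit b B (2 * j) = fstBits b (B * side n + j) := by
  have h1 : (2 * (j : ℤ)) % 2 = 0 := by omega
  have h2 : (2 * (j : ℤ)) / 2 = j := by omega
  rw [inpBit, if_pos h1, h2]
  congr 1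

theorem inpBit_snd (b : Fin (n + n) → Bool) (B j : ℕ) :
    inpBit b B (2 * j + 1) = sndBits b (B * side n + j) := by
  have h1 : ¬ (2 * (j : ℤ) + 1) % 2 = 0 := by omega
  have h2 : (2 * (j : ℤ) + 1) / 2 = j := by omega
  rw [inpBit, if_neg h1, h2]
  congr 1

/-- This justifies working on all blocks at once: equal digits fix the carry and unequal ones
transmit it, so the prefix action, applied to the carry into the block, gives the true carry at
every column. -/
theorem prefixCarry_getD (b : Fin (n + n) → Bool) (B j : ℕ) :
    (prefixCarry b B j).getD (carryBit (fstBits b) (sndBits b) (B * side n)) =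
      carryBit (fstBits b) (sndBits b) (B * side n + j) := by
  induction j with
  | zero => rfl
  | succ j ih =>
    rw [prefixCarry, inpBit_fst, inpBit_snd, ← add_assoc, carryBit, carryStep, ← ih]
    split_ifs <;> rfl

/-- The layout for the addition of two `n`-bit numbers. -/
def layout (b : Fin (n + n) → Bool) : Layout where
  s := side n
  s_pos := Int.natCast_pos.2 (side_pos n)
  inp := inpBit b
  real B x := B * side n + x / 2 < n
  pre B j := prefixCarry b B j.toNat
  carry B := carryBit (fstBits b) (sndBits b) (B.toNat * side n)
  pre_zero _ := rfl
  pre_succ B j _ _ hj _ := by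
    lift j to ℕ using hj
    rfl
  carry_zero := by simp [carryBit]
  carry_succ B hB _ := by
    lift B to ℕ using hB
    have := prefixCarry_getD b B (side n)
    simp only [Int.toNat_natCast, this]
    rw [show ((B : ℤ) + 1).toNat = B + 1 by omega, add_mul, one_mul]

theorem layout_sum (b : Fin (n + n) → Bool) (B j : ℕ) :
    (layout b).sum B j = sumBit (fstBits b) (sndBits b) (B * side n + j) := by
  simp only [Layout.sum, layout, Int.toNat_natCast, prefixCarry_getD, inpBit_fst, inpBit_snd,
    sumBit]

variable (n)

/-- The position with offset `e` (`0` or `1`) of bit `j`, in the row `k` of its block. -/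
def bitPos (j : ℕ) (e k : ℤ) : ℤ × ℤ :=
  (2 * ((j % side n : ℕ) : ℤ) + e, 5 * ((j / side n : ℕ) : ℤ) + k)

/-- The position of each input bit. -/
def inputPos (i : Fin (n + n)) : ℤ × ℤ :=
  Fin.addCases (fun i : Fin n => bitPos n (i.rev : ℕ) 0 1)
    (fun i : Fin n => bitPos n (i.rev : ℕ) 1 1) i

variable {n}

theorem bitPos_inj {i j : ℕ} {e e' k : ℤ} (he : e = 0 ∨ e = 1) (he' : e' = 0 ∨ e' = 1)
    (h : bitPos n i e k = bitPos n j e' k) : i = j ∧ e = e' := by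
  simp only [bitPos, Prod.mk.injEq] at h
  have h1 : i % side n = j % side n := by omega
  have h2 : i / side n = j / side n := by omega
  refine ⟨?_, by omega⟩
  rw [← Nat.div_add_mod i (side n), ← Nat.div_add_mod j (side n), h1, h2]

theorem inputPos_injective : Function.Injective (inputPos n) := by
  intro i j
  refine Fin.addCases (fun i => ?_) (fun i => ?_) i <;>
    refine Fin.addCases (fun j => ?_) (fun j => ?_) j <;>
    simp only [inputPos, Fin.addCases_left, Fin.addCases_right] <;> intro h <;>
    obtain ⟨h1, h2⟩ := bitPos_inj (by norm_num) (by norm_num) h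
  · rw [Fin.rev_injective (Fin.ext h1)]
  · simp at h2
  · simp at h2
  · rw [Fin.rev_injective (Fin.ext h1)]

theorem exists_bitPos {B y x : ℤ} (hy : y = 5 * B + 1) (hB : 0 ≤ B) (hx : 0 ≤ x)
    (hx' : x < 2 * side n) : ∃ j : ℕ, B * side n + x / 2 = j ∧ (x, y) = bitPos n j (x % 2) 1 := by
  lift B to ℕ using hB
  obtain ⟨m, hm⟩ : ∃ m : ℕ, x / 2 = m := ⟨(x / 2).toNat, by omega⟩
  have hms : m < side n := by omega
  refine ⟨B * side n + m, by rw [hm]; push_cast; ring, ?_⟩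
  have h1 : (B * side n + m) % side n = m := by
    rw [add_comm, Nat.add_mul_mod_self_right, Nat.mod_eq_of_lt hms]
  have h2 : (B * side n + m) / side n = B := by
    rw [add_comm, Nat.add_mul_div_right _ _ (side_pos n), Nat.div_eq_of_lt hms, zero_add]
  simp only [bitPos, h1, h2, Prod.mk.injEq]
  omega

theorem exists_inputPos {B y x : ℤ} (hy : y = 5 * B + 1) (hB : 0 ≤ B) (hx : 0 ≤ x)
    (hx' : x < 2 * side n) (hr : B * side n + x / 2 < n) : ∃ i, inputPos n i = (x, y) := by
  obtain ⟨j, hj, hxy⟩ := exists_bitPos hy hB hx hx'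
  have hjn : j < n := by omega
  rw [hxy]
  rcases Int.emod_two_eq_zero_or_one x with h | h
  · exact ⟨Fin.castAdd n (Fin.rev ⟨j, hjn⟩), by
      simp only [inputPos, Fin.addCases_left, Fin.rev_rev, h]⟩
  · exact ⟨Fin.natAdd n (Fin.rev ⟨j, hjn⟩), by
      simp only [inputPos, Fin.addCases_right, Fin.rev_rev, h]⟩

theorem cell_inputPos (b : Fin (n + n) → Bool) (i : Fin (n + n)) :
    (layout b).Cell true (inputPos n i).1 (inputPos n i).2 (.bit (b i)) := by
  have hs := side_pos n
  have key : ∀ (i : Fin n) (e : ℤ), e = 0 ∨ e = 1 →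
      (layout b).Cell true (bitPos n (i.rev : ℕ) e 1).1 (bitPos n (i.rev : ℕ) e 1).2
        (.bit (inpBit b ((i.rev / side n : ℕ) : ℤ) (2 * ((i.rev % side n : ℕ) : ℤ) + e))) := by
    intro i e he
    have h1 := Nat.mod_lt (i.rev : ℕ) hs
    have h2 := div_side_lt n i.rev.isLt.le
    have h3 := Nat.div_add_mod' (i.rev : ℕ) (side n)
    have h4 := i.rev.isLt
    refine .bit _ rfl (by positivity) (by simp only [layout]; omega) (by simp only [bitPos]; omega)
      (by simp only [layout, bitPos]; omega) ?_
    simp only [layout, bitPos]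
    rw [show (2 * (((i.rev : ℕ) % side n : ℕ) : ℤ) + e) / 2 = (((i.rev : ℕ) % side n : ℕ) : ℤ) by
      omega]
    exact_mod_cast h3 ▸ h4
  refine Fin.addCases (fun i => ?_) (fun i => ?_) i
  · have := key i 0 (.inl rfl)
    rw [add_zero] at this
    rw [inpBit_fst, Nat.div_add_mod', show fstBits b i.rev = b (Fin.castAdd n i) from
      (bitsOf_rev (fun i => b (Fin.castAdd n i)) i).symm] at this
    simpa only [inputPos, Fin.addCases_left] using this
  · have := key i 1 (.inr rfl)
    rw [inpBit_snd, Nat.div_add_mod', show sndBits b i.rev = b (Fin.natAdd n i) from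
      (bitsOf_rev (fun i => b (Fin.natAdd n i)) i).symm] at this
    simpa only [inputPos, Fin.addCases_right] using this

/-- The padding is the same for all inputs, so it can be part of the frame. -/
theorem inpBit_of_le (b : Fin (n + n) → Bool) {B x : ℤ} (h : ¬ B * side n + x / 2 < n) :
    inpBit b B x = false := by
  have : ¬ (B * side n + x / 2).toNat < n := by omega
  simp [inpBit, fstBits, sndBits, bitsOf, this]

/-- Away from the input positions the seed does not depend on the input. -/
theorem cell_of_ne (b c : Fin (n + n) → Bool) {x y : ℤ} (hp : ∀ i, inputPos n i ≠ (x, y))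
    {k : Kind} (h : (layout b).Cell true x y k) :
    (layout c).Cell true x y k ∧ ∀ d, k ≠ .bit d := by
  cases h
  case spine h1 h2 h3 h4 => exact ⟨.spine h1 h2 h3 h4, by simp⟩
  case start B h1 h2 h3 h4 => exact ⟨.start B h3 h4 h1 h2, by simp⟩
  case row B h1 h2 h3 h4 h5 => exact ⟨.row B h5 h1 h2 h3 h4, by simp⟩
  case zeroCarry h1 h2 => exact ⟨.zeroCarry h1 h2, by simp⟩
  case bit B h1 h2 h3 h4 h5 h6 =>
    obtain ⟨i, hi⟩ := exists_inputPos h6 h1 h3 h4 h5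
    exact absurd hi (hp i)
  case pad B h1 h2 h3 h4 h5 h6 =>
    have hb : (layout b).inp B x = (layout c).inp B x :=
      (inpBit_of_le b h5).trans (inpBit_of_le c h5).symm
    rw [hb]
    exact ⟨.pad B h6 h1 h2 h3 h4 h5, by simp⟩

variable (n)

/-- The seed without the input bits. -/
noncomputable def frame : Assembly Glue :=
  -- The zero input is an arbitrary choice: by `cell_of_ne` the seeds of all inputs agree off the
  -- input positions.
  (layout fun _ : Fin (n + n) => false).seed.restrict
    ((layout fun _ : Fin (n + n) => false).seed.dom \ Finset.univ.image (inputPos n))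

theorem frame_eq_some {p : ℤ × ℤ} {t : TileType Glue} : (frame n).tileAt p = some t ↔
    (∀ i, inputPos n i ≠ p) ∧
      (layout fun _ : Fin (n + n) => false).seed.tileAt p = some t := by
  simp only [frame, Assembly.restrict]
  split_ifs with h
  · simp only [Finset.mem_sdiff, Finset.mem_image, Finset.mem_univ, true_and, not_exists] at h
    exact ⟨fun h' => ⟨h.2, h'⟩, fun h' => h'.2⟩
  · simp only [false_iff]
    rintro ⟨h1, h2⟩
    refine h (Finset.mem_sdiff.2 ⟨Assembly.mem_dom_of_eq h2, ?_⟩)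
    simpa using h1

/-- The input template of the adder. -/
noncomputable def inputTemplate : InputTemplate tileSet (n + n) where
  bitTile c := (Kind.bit c).tile
  bitTile_mem c := mem_tiles.2 ⟨_, rfl⟩
  label_bitTile _ := rfl
  eq_bitTile c t ht h := by
    obtain ⟨k, rfl⟩ := mem_tiles.1 ht
    rw [label_eq_bitLabel h]
  frame := frame n
  frame_over p t h := by
    obtain ⟨hp, ht⟩ := (frame_eq_some n).1 h
    obtain ⟨k, hk, rfl⟩ := Layout.seed_eq_some.1 ht
    refine ⟨mem_tiles.2 ⟨k, rfl⟩, fun c hc => ?_⟩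
    exact (cell_of_ne _ (fun _ => false) hp hk).2 c
      (label_eq_bitLabel (by rw [hc]; rfl))
  pos := inputPos n
  pos_injective := inputPos_injective
  frame_pos i := by
    rw [← Assembly.notMem_dom]
    intro h
    obtain ⟨t, ht⟩ := Assembly.exists_of_mem_dom h
    exact ((frame_eq_some n).1 ht).1 i rfl

variable {n}

theorem fill_inputTemplate (b : Fin (n + n) → Bool) :
    (inputTemplate n).fill b = (layout b).seed := by
  ext1 p
  by_cases hp : ∃ i, inputPos n i = p
  · obtain ⟨i, rfl⟩ := hp
    rw [show inputPos n i = (inputTemplate n).pos i from rfl, InputTemplate.fill_pos]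
    exact (cell_inputPos b i).seed_tileAt.symm
  · rw [not_exists] at hp
    rw [InputTemplate.fill_of_ne _ _ _ hp]
    apply Option.ext
    intro t
    rw [show (inputTemplate n).frame = frame n from rfl, frame_eq_some, Layout.seed_eq_some,
      Layout.seed_eq_some]
    constructor
    · rintro ⟨-, k, hk, rfl⟩
      exact ⟨k, (cell_of_ne _ _ hp hk).1, rfl⟩
    · rintro ⟨k, hk, rfl⟩
      exact ⟨hp, k, (cell_of_ne _ _ hp hk).1, rfl⟩

variable (n)

/-- The adder for two `n`-bit numbers. -/
noncomputable def computer : TAC Glue (n + n) (n + 1) where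
  tileSet := tileSet
  input := inputTemplate n
  output i := bitPos n (i.rev : ℕ) 1 4
  temp := 2

variable {n}

theorem computer_system (b : Fin (n + n) → Bool) :
    (computer n).system b = (layout b).system := by
  simp only [TAC.system, computer, Layout.system, fill_inputTemplate]

theorem rank_lt (b : Fin (n + n) → Bool) :
    ∀ p ∈ (layout b).final.dom, (layout b).rank p < 9 * side n + 5 :=
  fun _ hp => Layout.rank_lt_of_mem hp

theorem represents (b : Fin (n + n) → Bool) :
    Represents (computer n).output (layout b).final
      fun i => sumBit (fstBits b) (sndBits b) (i.rev : ℕ) := by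
  intro i
  have h1 := Nat.mod_lt (i.rev : ℕ) (side_pos n)
  have h2 := div_side_lt n (Nat.le_of_lt_succ i.rev.isLt)
  have h := Layout.Cell.out (L := layout b) ((i.rev / side n : ℕ) : ℤ) ((i.rev % side n : ℕ) : ℤ)
    rfl rfl (by positivity) (by simp only [layout]; omega) (by positivity)
    (by simp only [layout]; omega)
  rw [layout_sum, Nat.div_add_mod'] at h
  exact ⟨_, h.tileAt, rfl⟩

theorem isAdder_computer : (computer n).IsAdder n := by
  refine ⟨fun b i => sumBit (fstBits b) (sndBits b) (i.rev : ℕ), fun b => ?_, fun b => ?_⟩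
  · rw [binaryValue_eq_sum _ (sumBit (fstBits b) (sndBits b)) fun _ => rfl,
      binaryValue_eq_sum _ (fstBits b) fun i => bitsOf_rev (fun i => b (Fin.castAdd n i)) i,
      binaryValue_eq_sum _ (sndBits b) fun i => bitsOf_rev (fun i => b (Fin.natAdd n i)) i,
      sum_add_sum_eq, Finset.sum_range_succ]
    -- Both summands have digit 0 at place `n`, so the top digit of the sum is the last carry.
    simp [sumBit, fstBits, sndBits, bitsOf]
  · rw [computer_system]
    exact ⟨Layout.growthPlan.valid, _, Layout.growthPlan.uniquelyAssembles (rank_lt b),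
      represents b⟩

theorem exists_hasWorstCaseRunTime_computer :
    ∃ w ≤ 9 * side n + 5, (computer n).HasWorstCaseRunTime w := by
  refine TAC.exists_hasWorstCaseRunTime _ fun b => ?_
  rw [computer_system]
  exact Layout.growthPlan.exists_hasParallelRunTime (rank_lt b)

end Template

end Adder

end TileAssembly

theorem mainTheorem3 :
    ∃ (G : Type) (T : TileAssembly.TileSet G) (τ : ℕ) (K : ℝ), ∀ n : ℕ, 1 ≤ n →
      ∃ I : TileAssembly.TAC G (n + n) (n + 1),
        I.tileSet = T ∧ I.temp = τ ∧ I.IsAdder n ∧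
          ∃ w : ℕ, I.HasWorstCaseRunTime w ∧ (w : ℝ) ≤ K * Real.sqrt n := by
  -- The bound `9 * (√n + 1) + 5` is at most `23 * √n` because `1 ≤ √n`.
  refine ⟨_, TileAssembly.Adder.tileSet, 2, 23, fun n hn =>
    ⟨TileAssembly.Adder.computer n, rfl, rfl, TileAssembly.Adder.isAdder_computer, ?_⟩⟩
  obtain ⟨w, hw, hrun⟩ := TileAssembly.Adder.exists_hasWorstCaseRunTime_computer (n := n)
  refine ⟨w, hrun, ?_⟩
  have h1 : (1 : ℝ) ≤ Real.sqrt n := Real.one_le_sqrt.2 (by exact_mod_cast hn)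
  have h2 : (Nat.sqrt n : ℝ) ≤ Real.sqrt n := Real.nat_sqrt_le_real_sqrt
  have h3 : (w : ℝ) ≤ 9 * ((Nat.sqrt n : ℝ) + 1) + 5 := by exact_mod_cast hw
  linarith
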